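/- Let $n\in\mathbb{N}$, $0<\alpha<1$, and let $\mathbb{D}\subset\mathbb{C}$ be the open unit disc. Identify $\mathbb{R}^{2n}$ with $\mathbb{C}^n$ and let $J_{st}$ be multiplication by $i$. Let $J$ be a smooth almost complex structure on $\mathbb{R}^{2n}$, that is, a $C^\infty$ map from $\mathbb{R}^{2n}$ to the real-linear endomorphisms of $\mathbb{R}^{2n}$ with $J(z)^2=-\mathrm{Id}$, such that $\det(J(z)+J_{st})\neq 0$ for every $z$. Put $A(z)v=(J_{st}+J(z))^{-1}(J(z)-J_{st})\bar v$ and, with $\zeta=x+iy$, $$\mathcal{F}(u)=u_{\bar\zeta}+A(u)\,\overline{u_\zeta}.$$ For an open set $\Omega\subset\mathbb{D}$ let $\|f\|_{C^{0,\alpha}(\overline\Omega)}$ be the sum of the supremum norm and of the $\alpha$-Hölder seminorm (for the Euclidean distance) of $f$ on $\Omega$, and let $\|f\|_{C^{1,\alpha}(\overline\Omega)}=\|f\|_{C^{0,\alpha}(\overline\Omega)}+\|df\|_{C^{0,\alpha}(\overline\Omega)}$; the space $C^{1,\alpha}(\overline\Omega)$ consists of the maps differentiable on $\Omega$ for which the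 latter is finite (these maps and their derivatives extend uniquely and continuously to $\overline\Omega$). Let $(\Omega_m)_{m\in\mathbb{N}}$ be any sequence of open subsets of $\mathbb{D}$ (for example, a shrinking family of neighbourhoods of an arc), and let $\varphi\in C^{1,\alpha}(\overline{\mathbb{D}})$ be a map into $\mathbb{R}^{2n}$ whose restrictions $\varphi_m=\varphi|_{\Omega_m}$ satisfy $$\lim_{m\to\infty}\|\mathcal{F}(\varphi_m)\|_{C^{0,\alpha}(\overline\Omega_m)}=0.$$ Then for every sufficiently large $m$ there exists a $J$-holomorphic map $u_m\colon\Omega_m\to\mathbb{R}^{2n}$, that is, a differentiable map with $J(u_m)\circ du_m=du_m\circ i$ on $\Omega_m$, such that $u_m\in C^{1,\alpha}(\overline\Omega_m)$ and $$\lim_{m\to\infty}\|u_m-\varphi_m\|_{C^{1,\alpha}(\overline\Omega_m)}=0.$$ -/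

import Mathlib

open Filter Topology
open scoped NNReal ENNReal

namespace JHolomorphic

/-- The space `ℂⁿ`, identified with `ℝ²ⁿ`, with its Euclidean norm. -/
abbrev Cn (n : ℕ) : Type := EuclideanSpace ℂ (Fin n)

noncomputable section

/-- The standard complex structure of `ℂⁿ`: multiplication by `i`. -/
def Jst (n : ℕ) : Cn n →L[ℝ] Cn n := Complex.I • ContinuousLinearMap.id ℝ (Cn n)

/-- Coordinatewise complex conjugation `v ↦ v̄` on `ℂⁿ`. -/
def conjCn {n : ℕ} (v : Cn n) : Cn n := WithLp.toLp 2 fun i => starRingEnd ℂ (v i)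

/-- The class of smooth almost complex structures `J` on `ℝ²ⁿ` such that
`det (J + J_st) ≠ 0` at every point. -/
structure IsAdmissible {n : ℕ} (J : Cn n → Cn n →L[ℝ] Cn n) : Prop where
  smooth : ContDiff ℝ ((⊤ : ℕ∞) : WithTop ℕ∞) J
  sq_eq : ∀ z, (J z).comp (J z) = -ContinuousLinearMap.id ℝ (Cn n)
  det_ne : ∀ z, (J z + Jst n).det ≠ 0

/-- The complex matrix of `J`: `A(z)(v) = (J_st + J(z))⁻¹ (J(z) - J_st) (v̄)`. -/
def complexMatrix {n : ℕ} (J : Cn n → Cn n →L[ℝ] Cn n) (z v : Cn n) : Cn n :=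
  (Jst n + J z).inverse ((J z - Jst n) (conjCn v))

/-- `u_ζ = (u_x - i u_y) / 2`, where `ζ = x + i y`. -/
def dZeta {n : ℕ} (u : ℂ → Cn n) (ζ : ℂ) : Cn n :=
  (2⁻¹ : ℂ) • (fderiv ℝ u ζ 1 - Complex.I • fderiv ℝ u ζ Complex.I)

/-- `u_ζ̄ = (u_x + i u_y) / 2`, where `ζ = x + i y`. -/
def dZetaBar {n : ℕ} (u : ℂ → Cn n) (ζ : ℂ) : Cn n :=
  (2⁻¹ : ℂ) • (fderiv ℝ u ζ 1 + Complex.I • fderiv ℝ u ζ Complex.I)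

/-- The operator `F(u) = u_ζ̄ + A(u) (conjugate of u_ζ)`. At the points of an open set it only
depends on the restriction of `u` to that set. -/
def opF {n : ℕ} (J : Cn n → Cn n →L[ℝ] Cn n) (u : ℂ → Cn n) (ζ : ℂ) : Cn n :=
  dZetaBar u ζ + complexMatrix J (u ζ) (conjCn (dZeta u ζ))

/-- `u` is `J`-holomorphic on the open set `Ω`: it is differentiable there and
`J(u(ζ)) ∘ d_ζ u = d_ζ u ∘ J_st` for every `ζ ∈ Ω`. -/
def IsJHolomorphicOn {n : ℕ} (J : Cn n → Cn n →L[ℝ] Cn n) (u : ℂ → Cn n) (Ω : Set ℂ) : Prop :=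
  DifferentiableOn ℝ u Ω ∧
    ∀ ζ ∈ Ω, ∀ v : ℂ, J (u ζ) (fderiv ℝ u ζ v) = fderiv ℝ u ζ (Complex.I * v)

/-- The norm of `C^{0,α}(Ω̄)`, with value `∞` outside that space: the supremum of `‖f‖` plus the
Hölder seminorm. It is computed on `Ω`; a function for which it is finite extends uniquely to
an `α`-Hölder function on the closure of `Ω`, and the extension has the same norm. -/
def normC0 {E : Type*} [NormedAddCommGroup E] (α : ℝ≥0) (Ω : Set ℂ) (f : ℂ → E) : ℝ≥0∞ :=
  (⨆ ζ ∈ Ω, ‖f ζ‖ₑ) + eHolderNorm α (Ω.domRestrict f)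

/-- The norm of `C^{1,α}(Ω̄)`, for `Ω` open and `f` differentiable on `Ω`, with value `∞` outside
that space: the sum of the `C^{0,α}` norms of `f` and of its derivative. -/
def normC1 {E : Type*} [NormedAddCommGroup E] [NormedSpace ℝ E] (α : ℝ≥0) (Ω : Set ℂ)
    (f : ℂ → E) : ℝ≥0∞ :=
  normC0 α Ω f + normC0 α Ω (fderiv ℝ f)

/-- `f` belongs to `C^{1,α}(Ω̄)`, for `Ω` open. -/
def MemC1 {E : Type*} [NormedAddCommGroup E] [NormedSpace ℝ E] (α : ℝ≥0) (Ω : Set ℂ)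
    (f : ℂ → E) : Prop :=
  DifferentiableOn ℝ f Ω ∧ normC1 α Ω f < ⊤

end

end JHolomorphic

/-!
The map `u` is sought in the form `u = φ + (J_st + J(φ)) v`, with `v` small. Since
`J(a) (J_st + J(a)) = (J_st + J(a)) J_st`, the equation `J(u) ∂₁ u = ∂ᵢ u`, multiplied by
`(J_st + J(φ))⁻¹`, becomes `Ψ(y, v, ∂₁ v, ∂ᵢ v) = 0`, where `y` is the 1-jet of `φ` and where
`Ψ(y, 0, p, q) = 𝓕(φ) + i (p + i q)` (`IsAdmissible.opF_eq`, `IsAdmissible.jetOperator_zero`).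
Here and below `∂₁` and `∂ᵢ` are the derivatives in the directions `1` and `i`, so that
`∂₁ + i ∂ᵢ` is twice the Cauchy-Riemann operator `∂̄`. Up to a constant
factor, the linearization at `v = 0` is thus `∂̄` plus a real-linear term `B v` of order zero, and
since `Ψ` contains no derivative of `y`, it is enough that `y` is of class `C^{0,α}`. The data `y` and `𝓕(φ)` are extended from the
disc, and from `Ω_m`, to the plane by McShane's theorem, with a constant that does not depend on
the set (`HolderBound.exists_extension`). All constants are therefore independent of `m`, and no
regularity of `Ω_m` is needed.

It remains to invert `∂̄ + B` and to absorb the quadratic terms. The Fock kernel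
`exp (2 b (z - w) w̄) / (z - w)` is, up to a constant factor, a fundamental solution of `∂̄`, because
it differs from the Cauchy kernel by a function that is holomorphic in `z`. In the supremum norm
with weight `exp (-b |z|²)` the associated operator is dominated by the convolution with
`|t|⁻¹ exp (-b |t|²)` (`norm_fock_kernel`), whose mass tends to `0` as `b → ∞`. For `b` large this
beats `B`, whatever its size, so that no Fredholm theory is involved. The bound from `C^{0,α}` to
`C^{1,α}` comes from a dyadic decomposition of the Cauchy kernel: the `k`-th piece of the
differentiated kernel has mean zero, hence contributes a function of size `2 ^ (-k α)` with
Lipschitz constant `2 ^ (k (1 - α))`, and such series are `α`-Hölder (`exists_holderBound_tsum`).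
These facts make up `exists_solutionOperator`.

The unknown of the fixed point problem is `g = (∂₁ + i ∂ᵢ) v`. It is a contraction for small data
in a norm that combines the weighted supremum norm with a Hölder seminorm of small weight `1 / L`
(`exists_solution_nonlinear`): first `b` is chosen to make `B` small in the weighted supremum norm,
then `L` so large that the Hölder seminorm of `B v`, which is bounded by the supremum norm of `g`,
is small, then the bound for the data so small that the quadratic terms are small. Applied to `Ψ`
this gives `exists_isJHolomorphicOn_near`: if the `C^{0,α}` norm of `𝓕(φ)` on `Ω` is `η ≤ δ`, there
is a `J`-holomorphic map on `Ω` at `C^{1,α}` distance at most a multiple of `η` from `φ`.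
-/

namespace JHolomorphic

open Set MeasureTheory

/-! ### Hölder bounds, superposition operators and extension -/

section HolderBound

variable {E F G : Type*} [NormedAddCommGroup E] [NormedAddCommGroup F] [NormedAddCommGroup G]
  {α M M' : ℝ} {S S' : Set ℂ} {f g : ℂ → E}

/-- `M` bounds both the supremum norm and the `α`-Hölder seminorm of `f` on `S`. -/
def HolderBound (α : ℝ) (S : Set ℂ) (M : ℝ) (f : ℂ → E) : Prop :=
  (∀ z ∈ S, ‖f z‖ ≤ M) ∧ ∀ z ∈ S, ∀ w ∈ S, ‖f z - f w‖ ≤ M * ‖z - w‖ ^ α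

/-- A real-linear map on the plane is controlled by its values at `1` and `i`. -/
theorem opNorm_le_of_apply {E : Type*} [NormedAddCommGroup E] [NormedSpace ℝ E] {T : ℂ →L[ℝ] E}
    {B B' : ℝ} (h1 : ‖T 1‖ ≤ B) (h2 : ‖T Complex.I‖ ≤ B') : ‖T‖ ≤ B + B' := by
  have hB : 0 ≤ B := (norm_nonneg _).trans h1
  have hB' : 0 ≤ B' := (norm_nonneg _).trans h2
  refine T.opNorm_le_bound (by positivity) fun e => ?_
  have he : e = e.re • (1 : ℂ) + e.im • Complex.I := by simp
  calc ‖T e‖ = ‖e.re • T 1 + e.im • T Complex.I‖ := by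
        conv_lhs => rw [he, map_add, map_smul, map_smul]
    _ ≤ |e.re| * B + |e.im| * B' := by
        refine (norm_add_le _ _).trans ?_
        rw [norm_smul, norm_smul, Real.norm_eq_abs, Real.norm_eq_abs]
        gcongr
    _ ≤ ‖e‖ * B + ‖e‖ * B' := by
        gcongr
        · exact Complex.abs_re_le_norm e
        · exact Complex.abs_im_le_norm e
    _ = (B + B') * ‖e‖ := by ring

namespace HolderBound

theorem mono_set (h : HolderBound α S M f) (hS : S' ⊆ S) : HolderBound α S' M f :=
  ⟨fun z hz => h.1 z (hS hz), fun z hz w hw => h.2 z (hS hz) w (hS hw)⟩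

theorem mono (h : HolderBound α S M f) (hM : M ≤ M') : HolderBound α S M' f :=
  ⟨fun z hz => (h.1 z hz).trans hM, fun z hz w hw => (h.2 z hz w hw).trans (by gcongr)⟩

theorem congr (h : HolderBound α S M f) (hfg : ∀ z ∈ S, g z = f z) : HolderBound α S M g :=
  ⟨fun z hz => by rw [hfg z hz]; exact h.1 z hz,
    fun z hz w hw => by rw [hfg z hz, hfg w hw]; exact h.2 z hz w hw⟩

theorem zero (α : ℝ) (S : Set ℂ) (hM : 0 ≤ M) : HolderBound α S M (fun _ => (0 : E)) :=
  ⟨fun z _ => by simpa using hM, fun z _ w _ => by simp only [sub_zero, norm_zero]; positivity⟩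

theorem add (hf : HolderBound α S M f) (hg : HolderBound α S M' g) :
    HolderBound α S (M + M') (fun z => f z + g z) := by
  refine ⟨fun z hz => (norm_add_le _ _).trans (add_le_add (hf.1 z hz) (hg.1 z hz)),
    fun z hz w hw => ?_⟩
  rw [add_sub_add_comm, add_mul]
  exact (norm_add_le _ _).trans (add_le_add (hf.2 z hz w hw) (hg.2 z hz w hw))

theorem prodMk {f : ℂ → E} {g : ℂ → F} (hf : HolderBound α S M f) (hg : HolderBound α S M g) :
    HolderBound α S M (fun z => (f z, g z)) :=
  ⟨fun z hz => norm_prod_le_iff.2 ⟨hf.1 z hz, hg.1 z hz⟩,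
    fun z hz w hw => norm_prod_le_iff.2 ⟨hf.2 z hz w hw, hg.2 z hz w hw⟩⟩

theorem comp_right (hf : HolderBound α S M f) (hα : 0 ≤ α) (hM : 0 ≤ M) {r : ℂ → ℂ}
    (hr : MapsTo r S' S) (hr1 : ∀ z w, ‖r z - r w‖ ≤ ‖z - w‖) :
    HolderBound α S' M (fun z => f (r z)) :=
  ⟨fun z hz => hf.1 _ (hr hz), fun z hz w hw => (hf.2 _ (hr hz) _ (hr hw)).trans (by
    have := hr1 z w
    gcongr)⟩

theorem continuous (hf : HolderBound α univ M f) (hα : 0 < α) : Continuous f := by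
  refine continuous_iff_continuousAt.2 fun w => tendsto_iff_norm_sub_tendsto_zero.2 ?_
  have : Tendsto (fun z => M * ‖z - w‖ ^ α) (𝓝 w) (𝓝 (M * ‖w - w‖ ^ α)) := by
    refine Continuous.tendsto (f := fun z => M * ‖z - w‖ ^ α) ?_ w
    exact continuous_const.mul ((continuous_id.sub continuous_const).norm.rpow_const
      fun _ => Or.inr hα.le)
  rw [sub_self, norm_zero, Real.zero_rpow hα.ne', mul_zero] at this
  exact squeeze_zero (fun _ => norm_nonneg _) (fun z => hf.2 z trivial w trivial) this

variable [NormedSpace ℝ E] [NormedSpace ℝ F] [NormedSpace ℝ G]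

theorem segment (hf : HolderBound α S M f) (hg : HolderBound α S M g) {t : ℝ}
    (ht : t ∈ Icc (0 : ℝ) 1) : HolderBound α S M (fun z => g z + t • (f z - g z)) := by
  have key : ∀ (a b : E) (B : ℝ), ‖a‖ ≤ B → ‖b‖ ≤ B → ‖(1 - t) • b + t • a‖ ≤ B := by
    intro a b B ha hb
    have := (convex_closedBall (0 : E) B) (x := b) (by simpa using hb) (y := a)
      (by simpa using ha) (sub_nonneg.2 ht.2) ht.1 (by ring)
    simpa using this
  refine ⟨fun z hz => ?_, fun z hz w hw => ?_⟩
  · have e : g z + t • (f z - g z) = (1 - t) • g z + t • f z := by module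
    simp only [e]
    exact key _ _ _ (hf.1 z hz) (hg.1 z hz)
  · have e : g z + t • (f z - g z) - (g w + t • (f w - g w))
        = (1 - t) • (g z - g w) + t • (f z - f w) := by module
    simp only [e]
    exact key _ _ _ (hf.2 z hz w hw) (hg.2 z hz w hw)

theorem clm_comp (hf : HolderBound α S M f) (L : E →L[ℝ] F) :
    HolderBound α S (‖L‖ * M) (fun z => L (f z)) := by
  refine ⟨fun z hz => L.le_opNorm_of_le (hf.1 z hz), fun z hz w hw => ?_⟩
  rw [← map_sub, mul_assoc]
  exact L.le_opNorm_of_le (hf.2 z hz w hw)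

theorem clm_apply {A : ℂ → F →L[ℝ] G} {v : ℂ → F} (hA : HolderBound α S M A)
    (hv : HolderBound α S M' v) : HolderBound α S (2 * M * M') (fun z => A z (v z)) := by
  have key : ∀ z ∈ S, ‖A z (v z)‖ ≤ M * M' := fun z hz =>
    (A z).le_of_opNorm_le_of_le (hA.1 z hz) (hv.1 z hz)
  refine ⟨fun z hz => (key z hz).trans ?_, fun z hz w hw => ?_⟩
  · have := (norm_nonneg _).trans (key z hz)
    linarith
  · have e : A z (v z) - A w (v w) = A z (v z - v w) + (A z - A w) (v w) := by
      simp
    rw [e]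
    calc _ ≤ M * (M' * ‖z - w‖ ^ α) + (M * ‖z - w‖ ^ α) * M' :=
          (norm_add_le _ _).trans (add_le_add
            ((A z).le_of_opNorm_le_of_le (hA.1 z hz) (hv.2 z hz w hw))
            ((A z - A w).le_of_opNorm_le_of_le (hA.2 z hz w hw) (hv.1 w hw)))
      _ = _ := by ring

/-- A real-linear-map-valued function on the plane is Hölder if its values at `1` and `i` are. -/
theorem of_apply {D : ℂ → ℂ →L[ℝ] E} (h1 : HolderBound α S M (fun z => D z 1))
    (h2 : HolderBound α S M (fun z => D z Complex.I)) : HolderBound α S (2 * M) D := by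
  refine ⟨fun z hz => ?_, fun z hz w hw => ?_⟩
  · rw [two_mul]
    exact opNorm_le_of_apply (h1.1 z hz) (h2.1 z hz)
  · rw [two_mul, add_mul]
    exact opNorm_le_of_apply (h1.2 z hz w hw) (h2.2 z hz w hw)

end HolderBound

/-- A bounded Lipschitz function is Hölder: at distance at most one use the Lipschitz bound, at
distance at least one the supremum bound. -/
theorem holderBound_of_lipschitz (hα0 : 0 < α) (hα1 : α < 1) (hM : 0 ≤ M)
    (h1 : ∀ z ∈ S, ‖f z‖ ≤ M) (h2 : ∀ z ∈ S, ∀ w ∈ S, ‖f z - f w‖ ≤ M * ‖z - w‖) :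
    HolderBound α S (2 * M) f := by
  refine ⟨fun z hz => (h1 z hz).trans (by linarith), fun z hz w hw => ?_⟩
  rcases le_total ‖z - w‖ 1 with h | h
  · refine (h2 z hz w hw).trans ?_
    have : ‖z - w‖ ≤ ‖z - w‖ ^ α := Real.self_le_rpow_of_le_one (norm_nonneg _) h hα1.le
    have h0 := norm_nonneg (z - w)
    nlinarith
  · have : 1 ≤ ‖z - w‖ ^ α := Real.one_le_rpow h hα0.le
    refine (norm_sub_le _ _).trans ((add_le_add (h1 z hz) (h1 w hw)).trans ?_)
    nlinarith

variable [NormedSpace ℝ E] [NormedSpace ℝ F] [NormedSpace ℝ G]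

/-- A `C¹` map of finite-dimensional spaces is bounded and Lipschitz on balls. -/
theorem exists_bound_lipschitz_of_contDiff [FiniteDimensional ℝ E] {Φ : E → F}
    (hΦ : ContDiff ℝ 1 Φ) (R : ℝ) : ∃ C, 0 ≤ C ∧ (∀ x, ‖x‖ ≤ R → ‖Φ x‖ ≤ C) ∧
      ∀ x y, ‖x‖ ≤ R → ‖y‖ ≤ R → ‖Φ x - Φ y‖ ≤ C * ‖x - y‖ := by
  have hK : IsCompact (Metric.closedBall (0 : E) R) := isCompact_closedBall _ _
  obtain ⟨C1, h1⟩ := hK.exists_bound_of_continuousOn hΦ.continuous.continuousOn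
  obtain ⟨C2, h2⟩ := hK.exists_bound_of_continuousOn
    (hΦ.continuous_fderiv one_ne_zero).continuousOn
  refine ⟨max 0 (max C1 C2), le_max_left _ _, fun x hx => ?_, fun x y hx hy => ?_⟩
  · exact (h1 x (by simpa using hx)).trans ((le_max_left _ _).trans (le_max_right _ _))
  · exact (convex_closedBall (0 : E) R).norm_image_sub_le_of_norm_fderiv_le
      (fun z _ => (hΦ.differentiable one_ne_zero) z)
      (fun z hz => (h2 z hz).trans ((le_max_right _ _).trans (le_max_right _ _)))
      (by simpa using hy) (by simpa using hx)

/-- Superposition with a `C¹` map is bounded in Hölder norm. -/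
theorem HolderBound.exists_contDiff_comp [FiniteDimensional ℝ E] {Φ : E → F}
    (hΦ : ContDiff ℝ 1 Φ) (α R : ℝ) : ∃ C, 0 ≤ C ∧ ∀ (S : Set ℂ) (f : ℂ → E),
      HolderBound α S R f → HolderBound α S C (fun z => Φ (f z)) := by
  obtain ⟨C, hC, h1, h2⟩ := exists_bound_lipschitz_of_contDiff hΦ R
  refine ⟨C + C * |R|, by positivity, fun S f hf => ⟨fun z hz => ?_, fun z hz w hw => ?_⟩⟩
  · exact (h1 _ (hf.1 z hz)).trans (by have : 0 ≤ C * |R| := by positivity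
                                       linarith)
  · refine (h2 _ _ (hf.1 z hz) (hf.1 w hw)).trans ?_
    have h3 := hf.2 z hz w hw
    have h4 : (0 : ℝ) ≤ ‖z - w‖ ^ α := by positivity
    calc C * ‖f z - f w‖ ≤ C * (|R| * ‖z - w‖ ^ α) := by
          gcongr
          exact h3.trans (by gcongr; exact le_abs_self R)
      _ ≤ (C + C * |R|) * ‖z - w‖ ^ α := by nlinarith [mul_nonneg hC h4]

/-- Mean value inequality in Hölder spaces: if along the segments from `x₂` to `x₁` the
derivative of `Φ` differs from `Λ` by at most `K`, then `Φ ∘ x₁ - Φ ∘ x₂` differs from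
`Λ (x₁ - x₂)` by at most `2 K ‖x₁ - x₂‖`, all in Hölder norms. -/
theorem HolderBound.comp_sub_comp_sub {Φ : E → F} (hΦ : Differentiable ℝ Φ) {x₁ x₂ : ℂ → E}
    {Λ : ℂ → E →L[ℝ] F} {K m : ℝ}
    (hK : ∀ t ∈ Icc (0 : ℝ) 1,
      HolderBound α S K (fun z => fderiv ℝ Φ (x₂ z + t • (x₁ z - x₂ z)) - Λ z))
    (hm : HolderBound α S m (fun z => x₁ z - x₂ z)) :
    HolderBound α S (2 * K * m) (fun z => Φ (x₁ z) - Φ (x₂ z) - Λ z (x₁ z - x₂ z)) := by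
  -- the mean value inequality in `t`, at one point `z` and for the difference at two points
  set h : ℂ → ℝ → F := fun z t => Φ (x₂ z + t • (x₁ z - x₂ z)) - t • Λ z (x₁ z - x₂ z) with hh
  have hd : ∀ z t, HasDerivAt (h z)
      ((fderiv ℝ Φ (x₂ z + t • (x₁ z - x₂ z)) - Λ z) (x₁ z - x₂ z)) t := by
    intro z t
    have h1 : HasDerivAt (fun t : ℝ => x₂ z + t • (x₁ z - x₂ z)) (x₁ z - x₂ z) t := by
      simpa using ((hasDerivAt_id t).smul_const (x₁ z - x₂ z)).const_add (x₂ z)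
    have h2 := (hΦ (x₂ z + t • (x₁ z - x₂ z))).hasFDerivAt.comp_hasDerivAt t h1
    have h3 : HasDerivAt (fun t : ℝ => t • Λ z (x₁ z - x₂ z)) (Λ z (x₁ z - x₂ z)) t := by
      simpa using (hasDerivAt_id t).smul_const (Λ z (x₁ z - x₂ z))
    rw [sub_apply]
    exact h2.sub h3
  have hb : ∀ t ∈ Icc (0 : ℝ) 1, HolderBound α S (2 * K * m)
      (fun z => (fderiv ℝ Φ (x₂ z + t • (x₁ z - x₂ z)) - Λ z) (x₁ z - x₂ z)) :=
    fun t ht => (hK t ht).clm_apply hm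
  have h01 : ∀ z, Φ (x₁ z) - Φ (x₂ z) - Λ z (x₁ z - x₂ z) = h z 1 - h z 0 := by
    intro z
    simp only [hh]
    simp
    abel
  refine ⟨fun z hz => ?_, fun z hz w hw => ?_⟩
  · simp only [h01]
    exact norm_image_sub_le_of_norm_deriv_le_segment_01'
      (fun t _ => (hd z t).hasDerivWithinAt)
      (fun t ht => (hb t (Ico_subset_Icc_self ht)).1 z hz)
  · simp only [h01]
    rw [sub_sub_sub_comm]
    exact norm_image_sub_le_of_norm_deriv_le_segment_01' (f := fun t => h z t - h w t)
      (fun t _ => ((hd z t).sub (hd w t)).hasDerivWithinAt)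
      (fun t ht => (hb t (Ico_subset_Icc_self ht)).2 z hz w hw)

/-- Superposition with a `C²` map is locally Lipschitz in Hölder norm. -/
theorem HolderBound.exists_comp_sub_comp [FiniteDimensional ℝ E] {Φ : E → F}
    (hΦ : ContDiff ℝ 2 Φ) (α R : ℝ) :
    ∃ C, 0 ≤ C ∧ ∀ (S : Set ℂ) (x₁ x₂ : ℂ → E) (m : ℝ),
      HolderBound α S R x₁ → HolderBound α S R x₂ → HolderBound α S m (fun z => x₁ z - x₂ z) →
      HolderBound α S (C * m) (fun z => Φ (x₁ z) - Φ (x₂ z)) := by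
  obtain ⟨C, hC, h⟩ := HolderBound.exists_contDiff_comp
    (hΦ.fderiv_right (m := 1) (by norm_num)) α R
  refine ⟨2 * C, by positivity, fun S x₁ x₂ m h1 h2 hm => ?_⟩
  have := HolderBound.comp_sub_comp_sub (hΦ.differentiable two_ne_zero) (Λ := fun _ => 0)
    (K := C) (x₁ := x₁) (x₂ := x₂) (S := S) (α := α) (fun t ht => ?_) hm
  · simpa using this
  · simpa using h S _ (h1.segment h2 ht)

/-- The part of `Ψ (y, ·)` of order two at `0` has small Lipschitz constant near `0`, in Hölder
norms. -/
theorem HolderBound.exists_remainder [FiniteDimensional ℝ E] [FiniteDimensional ℝ F]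
    {Ψ : E × F → G} (hΨ : ContDiff ℝ 3 Ψ) (α R : ℝ) :
    ∃ C, 0 ≤ C ∧ ∀ (S : Set ℂ) (y : ℂ → E) (V₁ V₂ : ℂ → F) (δ m : ℝ), δ ≤ R →
      HolderBound α S R y → HolderBound α S δ V₁ → HolderBound α S δ V₂ →
      HolderBound α S m (fun z => V₁ z - V₂ z) →
      HolderBound α S (C * δ * m) (fun z => Ψ (y z, V₁ z) - Ψ (y z, V₂ z)
        - fderiv ℝ Ψ (y z, 0) (0, V₁ z - V₂ z)) := by
  have h3 : (2 : WithTop ℕ∞) + 1 ≤ 3 := by norm_num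
  obtain ⟨C, hC, h⟩ := HolderBound.exists_comp_sub_comp (hΨ.fderiv_right (m := 2) h3) α R
  refine ⟨2 * C, by positivity, fun S y V₁ V₂ δ m hδ hy h1 h2 hm => ?_⟩
  rcases S.eq_empty_or_nonempty with rfl | ⟨z₀, hz₀⟩
  · exact ⟨by simp, by simp⟩
  have hδ0 : 0 ≤ δ := (norm_nonneg _).trans (h1.1 z₀ hz₀)
  have hm0 : 0 ≤ m := (norm_nonneg _).trans (hm.1 z₀ hz₀)
  have key := HolderBound.comp_sub_comp_sub (α := α) (S := S) (Φ := Ψ)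
    (hΨ.differentiable three_ne_zero)
    (x₁ := fun z => (y z, V₁ z)) (x₂ := fun z => (y z, V₂ z))
    (Λ := fun z => fderiv ℝ Ψ (y z, 0)) (K := C * δ) (m := m) ?_ ?_
  · refine (key.mono (le_of_eq (by ring))).congr fun z _ => ?_
    simp
  · intro t ht
    have hV := h1.segment h2 ht
    have := h S (fun z => (y z, V₂ z + t • (V₁ z - V₂ z))) (fun z => (y z, 0)) δ
      (hy.prodMk (hV.mono hδ)) (hy.prodMk (HolderBound.zero _ _ (hδ0.trans hδ))) ?_
    · refine this.congr fun z _ => ?_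
      simp
    · refine ((HolderBound.zero (E := E) α S hδ0).prodMk hV).congr fun z _ => ?_
      simp
  · refine ((HolderBound.zero (E := E) α S hm0).prodMk hm).congr fun z _ => ?_
    simp

/-- McShane's extension theorem for the snowflake metric `‖z - w‖ ^ α`, followed by a truncation
that preserves the bound for the supremum. -/
theorem HolderBound.exists_extension_real {f : ℂ → ℝ} (hα0 : 0 < α) (hα1 : α < 1) (hM : 0 ≤ M)
    (hf : HolderBound α S M f) : ∃ g : ℂ → ℝ, (∀ z ∈ S, g z = f z) ∧ HolderBound α univ (2 * M) g := by
  set e := Metric.Snowflaking.ofSnowflaking (X := ℂ) (α := α) (hα₀ := hα0) (hα₁ := hα1.le) with he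
  have hL : LipschitzOnWith M.toNNReal (fun x => f (e x)) (e ⁻¹' S) := by
    refine LipschitzOnWith.of_dist_le_mul fun x hx y hy => ?_
    have := hf.2 _ hx _ hy
    rw [Real.coe_toNNReal _ hM, dist_eq_norm]
    refine this.trans (le_of_eq ?_)
    rw [← dist_eq_norm, Metric.Snowflaking.dist_ofSnowflaking_ofSnowflaking, ← Real.rpow_mul
      dist_nonneg, inv_mul_cancel₀ hα0.ne', Real.rpow_one]
  obtain ⟨g, hg, hgf⟩ := hL.extend_real
  have hg' : ∀ z w : ℂ, |g (e.symm z) - g (e.symm w)| ≤ M * ‖z - w‖ ^ α := by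
    intro z w
    have := hg.dist_le_mul (e.symm z) (e.symm w)
    rw [Real.coe_toNNReal _ hM, Real.dist_eq] at this
    refine this.trans (le_of_eq ?_)
    rw [← dist_eq_norm, ← Metric.Snowflaking.dist_toSnowflaking_toSnowflaking]
    rfl
  refine ⟨fun z => max (-M) (min M (g (e.symm z))), fun z hz => ?_, fun z _ => ?_, fun z _ w _ => ?_⟩
  · have h1 : g (e.symm z) = f z := by
      rw [← hgf (show e.symm z ∈ e ⁻¹' S by simpa using hz)]
      simp
    have h2 := abs_le.1 (hf.1 z hz)
    simp only [h1]
    rw [min_eq_right h2.2, max_eq_right h2.1]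
  · rw [Real.norm_eq_abs, abs_le]
    exact ⟨by have := le_max_left (-M) (min M (g (e.symm z)))
              linarith,
      max_le (by linarith) ((min_le_left _ _).trans (by linarith))⟩
  · rw [Real.norm_eq_abs]
    refine (abs_max_sub_max_le_max _ _ _ _).trans ?_
    have h1 := (abs_min_sub_min_le_max M (g (e.symm z)) M (g (e.symm w))).trans
      (max_le (by simp) le_rfl)
    have h2 := hg' z w
    have h3 : 0 ≤ M * ‖z - w‖ ^ α := by positivity
    refine max_le (by simp; linarith) (by linarith)

/-- Hölder functions with values in a finite-dimensional space extend from an arbitrary set to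
the plane, with a loss that depends on the target space only. -/
theorem HolderBound.exists_extension (E : Type*) [NormedAddCommGroup E] [NormedSpace ℝ E]
    [FiniteDimensional ℝ E] (hα0 : 0 < α) (hα1 : α < 1) :
    ∃ C, 0 ≤ C ∧ ∀ (S : Set ℂ) (M : ℝ) (f : ℂ → E), 0 ≤ M → HolderBound α S M f →
      ∃ g : ℂ → E, (∀ z ∈ S, g z = f z) ∧ HolderBound α univ (C * M) g := by
  obtain ⟨L⟩ : Nonempty (E ≃L[ℝ] (Fin (Module.finrank ℝ E) → ℝ)) :=
    ⟨ContinuousLinearEquiv.ofFinrankEq (by simp)⟩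
  set L₁ : E →L[ℝ] (Fin (Module.finrank ℝ E) → ℝ) := L.toContinuousLinearMap with hL₁
  refine ⟨‖(L.symm : (Fin (Module.finrank ℝ E) → ℝ) →L[ℝ] E)‖ * (2 * ‖L₁‖),
    by positivity, fun S M f hM hf => ?_⟩
  have hi := fun i => HolderBound.exists_extension_real (α := α) (S := S)
    (M := ‖L₁‖ * M) (f := fun z => L (f z) i) hα0 hα1 (by positivity) ⟨fun z hz =>
      (norm_le_pi_norm (L (f z)) i).trans ((hf.clm_comp L₁).1 z hz), fun z hz w hw =>
      (norm_le_pi_norm (L (f z) - L (f w)) i).trans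
        ((hf.clm_comp L₁).2 z hz w hw)⟩
  choose g hg1 hg2 using hi
  have hg : HolderBound α univ (2 * (‖L₁‖ * M)) (fun z i => g i z) :=
    ⟨fun z hz => (pi_norm_le_iff_of_nonneg (by positivity)).2 fun i => (hg2 i).1 z hz,
      fun z hz w hw => (pi_norm_le_iff_of_nonneg (by positivity)).2 fun i => (hg2 i).2 z hz w hw⟩
  refine ⟨fun z => L.symm (fun i => g i z), fun z hz => ?_, ?_⟩
  · have : (fun i => g i z) = L (f z) := funext fun i => hg1 i z hz
    simp only [this, L.symm_apply_apply]
  · have := hg.clm_comp (L.symm : (Fin (Module.finrank ℝ E) → ℝ) →L[ℝ] E)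
    exact this.mono (le_of_eq (by ring))

end HolderBound

/-! ### Dyadic series -/

section DyadicSum

variable {E : Type*} [NormedAddCommGroup E] [CompleteSpace E] {α : ℝ}

/-- A series whose `k`-th term has size `2 ^ (-k α)` and Lipschitz constant `2 ^ (k (1 - α))`
is `α`-Hölder. Below, `q` is `2 ^ (-α)`. The terms with `2 ^ (-k) ≥ ‖z - w‖` are estimated by
their Lipschitz constants, the others by their size. -/
theorem exists_holderBound_tsum (hα0 : 0 < α) (hα1 : α < 1) : ∃ C, 0 ≤ C ∧
    ∀ (f : ℕ → ℂ → E) (M : ℝ), 0 ≤ M → (∀ k z, ‖f k z‖ ≤ M * ((2 : ℝ) ^ (-α)) ^ k) →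
      (∀ k z w, ‖f k z - f k w‖ ≤ M * (2 * (2 : ℝ) ^ (-α)) ^ k * ‖z - w‖) →
      HolderBound α univ (C * M) (fun z => ∑' k, f k z) := by
  set q : ℝ := (2 : ℝ) ^ (-α) with hq
  have hq0 : 0 < q := by positivity
  have hq1 : q < 1 := Real.rpow_lt_one_of_one_lt_of_neg one_lt_two (by linarith)
  have hq2 : 1 < 2 * q := by
    have : (2 : ℝ) ^ (-1 : ℝ) < q := Real.rpow_lt_rpow_of_exponent_lt one_lt_two (by linarith)
    rw [Real.rpow_neg_one] at this
    linarith
  have h1q : 0 < 1 - q := by linarith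
  have h2q : 0 < 2 * q - 1 := by linarith
  have hs : Summable fun k : ℕ => q ^ k := summable_geometric_of_lt_one hq0.le hq1
  refine ⟨2 / (2 * q - 1) + 2 / (1 - q), by positivity, fun f M hM h1 h2 => ?_⟩
  have hsum : ∀ z, Summable fun k => f k z := fun z =>
    Summable.of_norm_bounded (hs.mul_left M) fun k => h1 k z
  have hle : ∀ z, ‖∑' k, f k z‖ ≤ M / (1 - q) := fun z => by
    refine (tsum_of_norm_bounded (hs.mul_left M).hasSum fun k => h1 k z).trans (le_of_eq ?_)
    rw [tsum_mul_left, tsum_geometric_of_lt_one hq0.le hq1, div_eq_mul_inv]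
  have hc1 : 0 ≤ 2 / (2 * q - 1) := by positivity
  have hc2 : 2 * (M / (1 - q)) = 2 / (1 - q) * M := by ring
  have hc3 : 0 ≤ M / (1 - q) := by positivity
  refine ⟨fun z _ => (hle z).trans ?_, fun z _ w _ => ?_⟩
  · rw [add_mul, ← hc2]
    nlinarith [mul_nonneg hc1 hM]
  set d := ‖z - w‖ with hd
  rcases eq_or_lt_of_le (norm_nonneg (z - w)) with h0 | h0
  · have : z = w := by rw [← sub_eq_zero, ← norm_eq_zero, ← h0]
    subst this
    simp only [sub_self, norm_zero]
    positivity
  rcases le_or_gt 1 d with hd1 | hd1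
  · have : 1 ≤ d ^ α := Real.one_le_rpow hd1 hα0.le
    refine (norm_sub_le _ _).trans ((add_le_add (hle z) (hle w)).trans ?_)
    calc M / (1 - q) + M / (1 - q) = 2 / (1 - q) * M := by ring
      _ ≤ (2 / (2 * q - 1) + 2 / (1 - q)) * M := by gcongr; linarith
      _ ≤ (2 / (2 * q - 1) + 2 / (1 - q)) * M * d ^ α := le_mul_of_one_le_right (by positivity) this
  -- the terms of index at most `K` are those with `2 ^ (-k) ≥ d`
  obtain ⟨K, hK1, hK2⟩ := exists_nat_pow_near_of_lt_one h0 hd1.le (y := (1 / 2 : ℝ)) (by norm_num)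
    (by norm_num)
  have hqK : q ^ (K + 1) ≤ d ^ α := by
    have : q ^ (K + 1) = ((1 / 2 : ℝ) ^ (K + 1)) ^ α := by
      rw [← Real.rpow_natCast, ← Real.rpow_natCast, hq, ← Real.rpow_mul (by norm_num),
        ← Real.rpow_mul (by norm_num), one_div, Real.inv_rpow (by norm_num),
        ← Real.rpow_neg (by norm_num)]
      congr 1
      ring
    rw [this]
    exact Real.rpow_le_rpow (by positivity) hK1.le hα0.le
  have hdK : d * (2 : ℝ) ^ (K + 1) ≤ 2 := by
    calc d * (2 : ℝ) ^ (K + 1) ≤ (1 / 2) ^ K * 2 ^ (K + 1) :=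
          mul_le_mul_of_nonneg_right hK2 (by positivity)
      _ = 2 := by
          rw [pow_succ, ← mul_assoc, ← mul_pow]
          norm_num
  have hb : ∀ k, ‖f k z - f k w‖ ≤ 2 * (M * q ^ k) := fun k =>
    (norm_sub_le _ _).trans ((add_le_add (h1 k z) (h1 k w)).trans (le_of_eq (by ring)))
  have hsb : Summable fun k => ‖f k z - f k w‖ :=
    Summable.of_nonneg_of_le (fun _ => norm_nonneg _) hb ((hs.mul_left M).mul_left 2)
  rw [← (hsum z).tsum_sub (hsum w)]
  refine (norm_tsum_le_tsum_norm hsb).trans ?_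
  rw [← hsb.sum_add_tsum_nat_add (K + 1)]
  have t1 : ∑ k ∈ Finset.range (K + 1), ‖f k z - f k w‖ ≤ 2 / (2 * q - 1) * M * d ^ α := by
    calc _ ≤ ∑ k ∈ Finset.range (K + 1), M * (2 * q) ^ k * d :=
          Finset.sum_le_sum fun k _ => h2 k z w
      _ = M * d * (((2 * q) ^ (K + 1) - 1) / (2 * q - 1)) := by
          rw [← geom_sum_eq hq2.ne', Finset.mul_sum]
          exact Finset.sum_congr rfl fun k _ => by ring
      _ ≤ M * d * ((2 * q) ^ (K + 1) / (2 * q - 1)) := by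
          have := h0.le
          gcongr
          linarith
      _ = M / (2 * q - 1) * ((d * 2 ^ (K + 1)) * q ^ (K + 1)) := by rw [mul_pow]; ring
      _ ≤ M / (2 * q - 1) * (2 * d ^ α) := by gcongr
      _ = _ := by ring
  have t2 : ∑' k, ‖f (k + (K + 1)) z - f (k + (K + 1)) w‖ ≤ 2 / (1 - q) * M * d ^ α := by
    have hs' : Summable fun k => 2 * (M * q ^ (k + (K + 1))) :=
      (summable_nat_add_iff (f := fun k => 2 * (M * q ^ k)) (K + 1)).2
        ((hs.mul_left M).mul_left 2)
    calc _ ≤ ∑' k, 2 * (M * q ^ (k + (K + 1))) :=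
          ((summable_nat_add_iff (K + 1)).2 hsb).tsum_le_tsum (fun k => hb _) hs'
      _ = 2 * M * q ^ (K + 1) * ∑' k, q ^ k := by
          rw [← tsum_mul_left]
          exact tsum_congr fun k => by ring
      _ = 2 / (1 - q) * M * q ^ (K + 1) := by
          rw [tsum_geometric_of_lt_one hq0.le hq1]
          ring
      _ ≤ _ := by gcongr
  calc _ ≤ _ := add_le_add t1 t2
    _ = _ := by ring

end DyadicSum

/-! ### Convolutions with dilated kernels -/

section Convolution

variable {E : Type*} [NormedAddCommGroup E] [NormedSpace ℂ E] {α M : ℝ} {κ : ℂ → ℂ} {g : ℂ → E}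

theorem integrable_conv (hκ : Continuous κ) (hc : HasCompactSupport κ) (hg : Continuous g) (z : ℂ) :
    Integrable fun t => κ t • g (z - t) :=
  (hκ.smul (hg.comp (continuous_const.sub continuous_id))).integrable_of_hasCompactSupport
    hc.smul_right

variable [NormedSpace ℝ E]

/-- Convolution on the plane of a scalar kernel with a vector-valued function. -/
noncomputable def conv (κ : ℂ → ℂ) (g : ℂ → E) (z : ℂ) : E := ∫ t, κ t • g (z - t)

/-- The derivative of a scalar kernel in the direction `e`. -/
noncomputable def dirDeriv (e : ℂ) (κ : ℂ → ℂ) (t : ℂ) : ℂ := fderiv ℝ κ t e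

/-- The dilation `t ↦ R ^ j κ (R t)` of a kernel. -/
noncomputable def dilate (j : ℕ) (R : ℝ) (κ : ℂ → ℂ) (t : ℂ) : ℂ := ((R ^ j : ℝ) : ℂ) * κ (R • t)

theorem _root_.HasCompactSupport.dirDeriv (hc : HasCompactSupport κ) (e : ℂ) :
    HasCompactSupport (dirDeriv e κ) :=
  hc.fderiv_apply ℝ e

theorem _root_.ContDiff.dirDeriv {m n : WithTop ℕ∞} (h : ContDiff ℝ n κ) (hmn : m + 1 ≤ n) (e : ℂ) :
    ContDiff ℝ m (dirDeriv e κ) :=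
  (h.fderiv_right hmn).clm_apply contDiff_const

theorem _root_.HasCompactSupport.dilate (hc : HasCompactSupport κ) (j : ℕ) {R : ℝ} (hR : R ≠ 0) :
    HasCompactSupport (dilate j R κ) :=
  (hc.comp_homeomorph (Homeomorph.smulOfNeZero R hR)).mul_left

theorem _root_.ContDiff.dilate {n : WithTop ℕ∞} (h : ContDiff ℝ n κ) (j : ℕ) (R : ℝ) :
    ContDiff ℝ n (dilate j R κ) :=
  contDiff_const.mul (h.comp (contDiff_const_smul R))

theorem dirDeriv_dilate (h : Differentiable ℝ κ) (e : ℂ) (j : ℕ) (R : ℝ) :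
    dirDeriv e (dilate j R κ) = dilate (j + 1) R (dirDeriv e κ) := by
  funext t
  have h1 : HasFDerivAt (fun t : ℂ => κ (R • t))
      ((fderiv ℝ κ (R • t)).comp (R • ContinuousLinearMap.id ℝ ℂ)) t :=
    (h (R • t)).hasFDerivAt.comp t ((hasFDerivAt_id t).const_smul R)
  have h2 := h1.const_mul ((R ^ j : ℝ) : ℂ)
  unfold dirDeriv
  rw [HasFDerivAt.fderiv (f := dilate j R κ) h2]
  simp [dilate, pow_succ]
  ring

theorem integral_dirDeriv (hκ : ContDiff ℝ 1 κ) (hc : HasCompactSupport κ) (e : ℂ) :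
    ∫ t, dirDeriv e κ t = 0 := by
  unfold dirDeriv
  have hi : Integrable (fun t => fderiv ℝ κ t e) :=
    (hκ.dirDeriv (m := 0) (by simp) e).continuous.integrable_of_hasCompactSupport (hc.dirDeriv e)
  have := integral_smul_fderiv_eq_neg_fderiv_smul_of_integrable (μ := volume) (𝕜 := ℂ)
    (f := fun _ : ℂ => (1 : ℂ)) (g := κ) (v := e) (by simp) (by simpa using hi)
    (by simpa using hκ.continuous.integrable_of_hasCompactSupport hc)
    (fun _ _ => differentiableAt_const _) (fun x _ => hκ.differentiable one_ne_zero x)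
  simpa using this

theorem integral_dilate (j : ℕ) {R : ℝ} (hR : 0 < R) :
    ∫ t, dilate j R κ t = ((R ^ j * (R ^ 2)⁻¹ : ℝ) : ℂ) * ∫ t, κ t := by
  unfold dilate
  rw [integral_const_mul, Measure.integral_comp_smul_of_nonneg volume _ R (hR := hR.le),
    Complex.finrank_real_complex]
  simp [mul_assoc]

theorem integral_norm_dilate (j : ℕ) {R : ℝ} (hR : 0 < R) :
    ∫ t, ‖dilate j R κ t‖ = R ^ j * (R ^ 2)⁻¹ * ∫ t, ‖κ t‖ := by
  unfold dilate
  simp only [norm_mul, Complex.norm_real, Real.norm_eq_abs, abs_of_pos (pow_pos hR j)]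
  rw [integral_const_mul, Measure.integral_comp_smul_of_nonneg volume (fun t => ‖κ t‖) R (hR := hR.le),
    Complex.finrank_real_complex]
  simp [mul_assoc]

theorem integral_norm_dilate_mul_rpow (j : ℕ) {R : ℝ} (hR : 0 < R) :
    ∫ t, ‖dilate j R κ t‖ * ‖t‖ ^ α = R ^ j * (R ^ 2)⁻¹ * R ^ (-α) * ∫ t, ‖κ t‖ * ‖t‖ ^ α := by
  have : ∀ t, ‖dilate j R κ t‖ * ‖t‖ ^ α
      = R ^ j * R ^ (-α) * (fun t => ‖κ t‖ * ‖t‖ ^ α) (R • t) := by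
    intro t
    simp only [dilate, norm_mul, Complex.norm_real, Real.norm_eq_abs, abs_of_pos (pow_pos hR j),
      norm_smul, abs_of_pos hR]
    rw [Real.mul_rpow hR.le (norm_nonneg _), Real.rpow_neg hR.le]
    have : R ^ α ≠ 0 := by positivity
    field_simp
  simp only [this]
  rw [integral_const_mul, Measure.integral_comp_smul_of_nonneg volume (fun t => ‖κ t‖ * ‖t‖ ^ α) R (hR := hR.le),
    Complex.finrank_real_complex, smul_eq_mul]
  ring

theorem norm_conv_le (hκ : Continuous κ) (hc : HasCompactSupport κ) (hg : ∀ z, ‖g z‖ ≤ M) (z : ℂ) :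
    ‖conv κ g z‖ ≤ (∫ t, ‖κ t‖) * M := by
  rw [← integral_mul_const]
  refine norm_integral_le_of_norm_le
    ((hκ.norm.integrable_of_hasCompactSupport hc.norm).mul_const M) (ae_of_all _ fun t => ?_)
  rw [norm_smul]
  gcongr
  exact hg _

/-- The cancellation `∫ κ = 0` gains the factor `‖t‖ ^ α`. -/
theorem norm_conv_le_of_integral_eq_zero [CompleteSpace E] (hκ : Continuous κ) (hc : HasCompactSupport κ)
    (h0 : ∫ t, κ t = 0) (hα : 0 < α) (hg : HolderBound α univ M g) (z : ℂ) :
    ‖conv κ g z‖ ≤ (∫ t, ‖κ t‖ * ‖t‖ ^ α) * M := by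
  have hgc := hg.continuous hα
  have e : conv κ g z = ∫ t, κ t • (g (z - t) - g z) := by
    have hi : Integrable fun t => κ t • g z :=
      (hκ.smul continuous_const).integrable_of_hasCompactSupport hc.smul_right
    simp only [smul_sub]
    rw [integral_sub (integrable_conv hκ hc hgc z) hi, integral_smul_const, h0, zero_smul, sub_zero]
    rfl
  rw [e, ← integral_mul_const]
  refine norm_integral_le_of_norm_le (Integrable.mul_const ?_ M) (ae_of_all _ fun t => ?_)
  · refine Continuous.integrable_of_hasCompactSupport ?_ hc.norm.mul_right
    exact hκ.norm.mul (continuous_norm.rpow_const fun _ => Or.inr hα.le)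
  · rw [norm_smul, mul_assoc, mul_comm _ M]
    gcongr
    simpa using hg.2 (z - t) trivial z trivial

variable [IsScalarTower ℝ ℂ E]

theorem hasFDerivAt_conv (hκ : ContDiff ℝ 1 κ) (hc : HasCompactSupport κ) (hg : Continuous g)
    (z : ℂ) : ∃ D : ℂ →L[ℝ] E, HasFDerivAt (conv κ g) D z ∧ ∀ e, D e = conv (dirDeriv e κ) g z := by
  refine ⟨_, hc.hasFDerivAt_convolution_left (ContinuousLinearMap.lsmul ℝ ℂ) hκ
    hg.locallyIntegrable z, fun e => ?_⟩
  have hint : Integrable fun t =>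
      ((ContinuousLinearMap.lsmul ℝ ℂ).precompL ℂ (fderiv ℝ κ t)) (g (z - t)) :=
    (hc.fderiv ℝ).convolutionExists_left _ (hκ.continuous_fderiv one_ne_zero)
      hg.locallyIntegrable z
  unfold convolution
  rw [ContinuousLinearMap.integral_apply hint]
  rfl

/-- Bounds for the convolutions with the derivatives of the kernel give a Lipschitz bound. -/
theorem norm_conv_sub_conv_le (hκ : ContDiff ℝ 1 κ) (hc : HasCompactSupport κ) (hg : Continuous g)
    {B : ℝ} (h1 : ∀ z, ‖conv (dirDeriv 1 κ) g z‖ ≤ B)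
    (h2 : ∀ z, ‖conv (dirDeriv Complex.I κ) g z‖ ≤ B) (z w : ℂ) :
    ‖conv κ g z - conv κ g w‖ ≤ 2 * B * ‖z - w‖ := by
  choose D hD hDe using fun z => hasFDerivAt_conv hκ hc hg z
  refine convex_univ.norm_image_sub_le_of_norm_hasFDerivWithin_le (f' := D)
    (fun x _ => (hD x).hasFDerivWithinAt) (fun x _ => ?_) trivial trivial
  rw [two_mul]
  refine opNorm_le_of_apply ?_ ?_
  · rw [hDe]
    exact h1 x
  · rw [hDe]
    exact h2 x

end Convolution

/-! ### The dyadic pieces of the Cauchy kernel -/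

section CauchyKernel

/-- A smooth radial cutoff, equal to `1` on the disc of radius `8` and to `0` off the disc of
radius `12`. -/
noncomputable def radialCutoff (w : ℂ) : ℂ := (Real.smoothTransition (2 - ‖w‖ ^ 2 / 64) : ℝ)

/-- The dyadic piece of the Cauchy kernel `1 / w`, smooth and supported in an annulus: the dilates
`2 ^ k * cauchyPiece (2 ^ k w)`, for `k ≥ 0`, sum up to `radialCutoff w / w`. -/
noncomputable def cauchyPiece (w : ℂ) : ℂ := (radialCutoff w - radialCutoff ((2 : ℝ) • w)) / w

/-- The radial density such that `(∂₁ + i ∂ᵢ) radialCutoff (w) = - w * radialMass w`; its dilates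
are an approximate identity. -/
noncomputable def radialMass (w : ℂ) : ℂ :=
  (1 / 32 * deriv Real.smoothTransition (2 - ‖w‖ ^ 2 / 64) : ℝ)

theorem contDiff_radialCutoff {n : ℕ∞} : ContDiff ℝ n radialCutoff :=
  Complex.ofRealCLM.contDiff.comp (Real.smoothTransition.contDiff.comp
    (contDiff_const.sub ((contDiff_norm_sq ℝ).div_const _)))

theorem radialCutoff_of_norm_le {w : ℂ} (h : ‖w‖ ≤ 8) : radialCutoff w = 1 := by
  have : (1 : ℝ) ≤ 2 - ‖w‖ ^ 2 / 64 := by nlinarith [norm_nonneg w]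
  simp [radialCutoff, Real.smoothTransition.one_of_one_le this]

theorem radialCutoff_of_le_norm {w : ℂ} (h : 12 ≤ ‖w‖) : radialCutoff w = 0 := by
  have : (2 : ℝ) - ‖w‖ ^ 2 / 64 ≤ 0 := by nlinarith [norm_nonneg w]
  simp [radialCutoff, Real.smoothTransition.zero_of_nonpos this]

theorem norm_radialCutoff_le (w : ℂ) : ‖radialCutoff w‖ ≤ 1 := by
  simp only [radialCutoff, Complex.norm_real, Real.norm_eq_abs,
    abs_of_nonneg (Real.smoothTransition.nonneg _)]
  exact Real.smoothTransition.le_one _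

theorem cauchyPiece_of_norm_le {w : ℂ} (h : ‖w‖ ≤ 4) : cauchyPiece w = 0 := by
  have h2 : ‖(2 : ℝ) • w‖ ≤ 8 := by rw [norm_smul]; norm_num; linarith
  rw [cauchyPiece, radialCutoff_of_norm_le h2, radialCutoff_of_norm_le (by linarith), sub_self,
    zero_div]

theorem contDiff_cauchyPiece {n : ℕ∞} : ContDiff ℝ n cauchyPiece := by
  refine contDiff_iff_contDiffAt.2 fun w => ?_
  rcases eq_or_ne w 0 with rfl | hw
  · refine (contDiffAt_const (c := (0 : ℂ))).congr_of_eventuallyEq ?_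
    filter_upwards [Metric.closedBall_mem_nhds (0 : ℂ) (by norm_num : (0 : ℝ) < 4)] with w hw
    exact cauchyPiece_of_norm_le (by simpa using hw)
  · exact (contDiff_radialCutoff.contDiffAt.sub
      (contDiff_radialCutoff.comp (contDiff_const_smul (2 : ℝ))).contDiffAt).mul
      ((contDiffAt_inv ℂ hw).restrict_scalars ℝ)

theorem hasCompactSupport_cauchyPiece : HasCompactSupport cauchyPiece := by
  refine HasCompactSupport.of_support_subset_isCompact (isCompact_closedBall (0 : ℂ) 12)
    fun w hw => ?_
  by_contra h
  have h1 : 12 < ‖w‖ := by simpa using h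
  have h2 : 12 ≤ ‖(2 : ℝ) • w‖ := by rw [norm_smul]; norm_num; linarith
  exact hw (by rw [cauchyPiece, radialCutoff_of_le_norm h1.le, radialCutoff_of_le_norm h2, sub_self,
    zero_div])

theorem radialMass_of_norm_lt {w : ℂ} (h : ‖w‖ < 8) : radialMass w = 0 := by
  have h1 : (1 : ℝ) < 2 - ‖w‖ ^ 2 / 64 := by nlinarith [norm_nonneg w]
  have h2 : Real.smoothTransition =ᶠ[𝓝 (2 - ‖w‖ ^ 2 / 64)] fun _ => (1 : ℝ) := by
    filter_upwards [lt_mem_nhds h1] with s hs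
    exact Real.smoothTransition.one_of_one_le hs.le
  simp [radialMass, h2.deriv_eq]

theorem continuous_radialMass : Continuous radialMass := by
  refine Complex.continuous_ofReal.comp (continuous_const.mul
    ((Real.smoothTransition.contDiff (n := 1)).continuous_deriv (by simp) |>.comp ?_))
  fun_prop

theorem hasCompactSupport_radialMass : HasCompactSupport radialMass := by
  refine HasCompactSupport.of_support_subset_isCompact (isCompact_closedBall (0 : ℂ) 12)
    fun w hw => ?_
  by_contra h
  have h1 : 12 < ‖w‖ := by simpa using h
  have h0 : (2 : ℝ) - ‖w‖ ^ 2 / 64 < 0 := by nlinarith [norm_nonneg w]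
  have h2 : Real.smoothTransition =ᶠ[𝓝 (2 - ‖w‖ ^ 2 / 64)] fun _ => (0 : ℝ) := by
    filter_upwards [gt_mem_nhds h0] with s hs
    exact Real.smoothTransition.zero_of_nonpos hs.le
  exact hw (by simp [radialMass, h2.deriv_eq])

theorem exists_integral_radialMass : ∃ c : ℝ, 0 < c ∧ ∫ w, radialMass w = (c : ℂ) := by
  set b : ℂ → ℝ := fun w => 1 / 32 * deriv Real.smoothTransition (2 - ‖w‖ ^ 2 / 64) with hb
  refine ⟨∫ w, b w, ?_, integral_ofReal⟩
  have hbm : ∀ w, radialMass w = (b w : ℂ) := fun w => rfl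
  have hbc : Continuous b := by
    refine continuous_const.mul
      ((Real.smoothTransition.contDiff (n := 1)).continuous_deriv (by simp) |>.comp ?_)
    fun_prop
  have hs : HasCompactSupport b := by
    refine hasCompactSupport_radialMass.mono fun w hw => ?_
    simpa [hbm] using hw
  obtain ⟨s, hs01, hs'⟩ := exists_deriv_eq_slope Real.smoothTransition zero_lt_one
    Real.smoothTransition.continuous.continuousOn
    (Real.smoothTransition.contDiff (n := 1)).differentiable_one.differentiableOn
  -- the radius at which the cutoff profile has the slope given by the mean value theorem
  have hw : ‖((Real.sqrt (64 * (2 - s)) : ℝ) : ℂ)‖ ^ 2 = 64 * (2 - s) := by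
    rw [Complex.norm_real, Real.norm_eq_abs, sq_abs, Real.sq_sqrt]
    linarith [hs01.2]
  refine hbc.integral_pos_of_hasCompactSupport_nonneg_nonzero hs (fun w => ?_)
    (x := ((Real.sqrt (64 * (2 - s)) : ℝ) : ℂ)) ?_
  · exact mul_nonneg (by norm_num) Real.smoothTransition.monotone.deriv_nonneg
  · simp only [hb, hw]
    have : 2 - 64 * (2 - s) / 64 = s := by ring
    rw [this, hs']
    simp

theorem dirDeriv_radialCutoff (e w : ℂ) :
    dirDeriv e radialCutoff w = -radialMass w * (inner ℝ w e : ℝ) := by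
  have h1 : HasFDerivAt (fun w : ℂ => 2 - ‖w‖ ^ 2 / 64) (-((64 : ℝ)⁻¹ • (2 • innerSL ℝ w))) w := by
    have := ((hasStrictFDerivAt_norm_sq w).hasFDerivAt.const_mul (64 : ℝ)⁻¹).const_sub 2
    refine this.congr_of_eventuallyEq (Eventually.of_forall fun w => ?_)
    simp only
    ring
  have h2 := ((Real.smoothTransition.contDiff (n := 1)).differentiable_one
    (2 - ‖w‖ ^ 2 / 64)).hasDerivAt.comp_hasFDerivAt w h1
  have h3 := Complex.ofRealCLM.hasFDerivAt.comp w h2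
  unfold dirDeriv
  rw [HasFDerivAt.fderiv (f := radialCutoff) h3]
  simp [radialMass]
  ring

/-- The `∂̄`-derivative of the dyadic piece is a difference of dilates of one function. -/
theorem dbar_cauchyPiece (w : ℂ) :
    dirDeriv 1 cauchyPiece w + Complex.I * dirDeriv Complex.I cauchyPiece w
      = dilate 2 2 radialMass w - radialMass w := by
  rcases eq_or_ne w 0 with rfl | hw
  · have h : cauchyPiece =ᶠ[𝓝 0] fun _ => 0 := by
      filter_upwards [Metric.closedBall_mem_nhds (0 : ℂ) (by norm_num : (0 : ℝ) < 4)] with w hw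
      exact cauchyPiece_of_norm_le (by simpa using hw)
    have h0 : radialMass 0 = 0 := radialMass_of_norm_lt (by simp)
    simp [dirDeriv, h.fderiv_eq, dilate, h0]
  · have key : ∀ e, e * cauchyPiece w + w * dirDeriv e cauchyPiece w
        = dirDeriv e radialCutoff w - dilate 1 2 (dirDeriv e radialCutoff) w := by
      intro e
      have h1 : HasFDerivAt (fun w => w * cauchyPiece w) _ w := (hasFDerivAt_id w).mul
        ((contDiff_cauchyPiece (n := 1)).differentiable_one w).hasFDerivAt
      have h2 : (fun w => w * cauchyPiece w) = fun w => radialCutoff w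
          - dilate 0 2 radialCutoff w := by
        funext w
        rcases eq_or_ne w 0 with rfl | hw
        · simp [dilate]
        · simp [cauchyPiece, dilate, mul_div_cancel₀ _ hw]
      have hd := (contDiff_radialCutoff (n := 1)).differentiable_one
      have h3 := (hd w).hasFDerivAt.sub
        (((contDiff_radialCutoff (n := 1)).dilate 0 2).differentiable_one w).hasFDerivAt
      have h4 := congrArg (fun D : ℂ →L[ℝ] ℂ => D e) (h1.unique (h3.congr_of_eventuallyEq
        (Eventually.of_forall (congrFun h2))))
      rw [← dirDeriv_dilate hd]
      simp [dirDeriv] at h4 ⊢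
      rw [← h4]
      ring
    have k1 := key 1
    have k2 := key Complex.I
    simp only [dilate, dirDeriv_radialCutoff] at k1 k2 ⊢
    have i1 : ∀ w : ℂ, ((inner ℝ w 1 : ℝ) : ℂ) + Complex.I * ((inner ℝ w Complex.I : ℝ) : ℂ) = w := by
      intro w
      simp only [Complex.inner]
      simp
      rw [mul_comm, Complex.re_add_im]
    have i2 := i1 ((2 : ℝ) • w)
    have i3 := i1 w
    have I2 := Complex.I_mul_I
    refine mul_left_cancel₀ hw ?_
    have e2 : (((2 : ℝ) • w : ℂ)) = 2 * w := by simp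
    set a := ((inner ℝ w 1 : ℝ) : ℂ)
    set b := ((inner ℝ w Complex.I : ℝ) : ℂ)
    set a' := ((inner ℝ ((2 : ℝ) • w) 1 : ℝ) : ℂ)
    set b' := ((inner ℝ ((2 : ℝ) • w) Complex.I : ℝ) : ℂ)
    rw [e2] at i2
    push_cast at *
    linear_combination k1 + Complex.I * k2 - cauchyPiece w * I2 - radialMass w * i3
      + 2 * radialMass ((2 : ℝ) • w) * i2

end CauchyKernel

/-! ### The truncated Cauchy transform -/

section CauchyTransform

variable {E : Type*} [NormedAddCommGroup E] [NormedSpace ℂ E] [NormedSpace ℝ E]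
  {α M : ℝ} {κ κ' : ℂ → ℂ} {g g' : ℂ → E}

theorem conv_sub_right (hκ : Continuous κ) (hc : HasCompactSupport κ) (hg : Continuous g)
    (hg' : Continuous g') (z : ℂ) :
    conv κ (fun w => g w - g' w) z = conv κ g z - conv κ g' z := by
  unfold conv
  rw [← integral_sub (integrable_conv hκ hc hg z) (integrable_conv hκ hc hg' z)]
  simp only [smul_sub]

theorem two_pow_rpow_neg (k : ℕ) : ((2 : ℝ) ^ k) ^ (-α) = ((2 : ℝ) ^ (-α)) ^ k := by
  rw [← Real.rpow_natCast, ← Real.rpow_natCast, ← Real.rpow_mul (by norm_num),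
    ← Real.rpow_mul (by norm_num), mul_comm]

/-- The dilates of `radialMass` are an approximate identity. -/
theorem tendsto_conv_radialMass [CompleteSpace E] (hα0 : 0 < α) (hg : HolderBound α univ M g)
    (z : ℂ) :
    Tendsto (fun k : ℕ => conv (dilate 2 (2 ^ k) radialMass) g z) atTop
      (𝓝 ((∫ t, radialMass t) • g z)) := by
  have hgc := hg.continuous hα0
  rw [tendsto_iff_norm_sub_tendsto_zero]
  have hz : Tendsto (fun k : ℕ => ((2 : ℝ) ^ (-α)) ^ k * ((∫ t, ‖radialMass t‖ * ‖t‖ ^ α) * M)) atTop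
      (𝓝 0) := by
    have := (tendsto_pow_atTop_nhds_zero_of_lt_one (by positivity)
      (Real.rpow_lt_one_of_one_lt_of_neg one_lt_two (by linarith : -α < 0))).mul_const
      ((∫ t, ‖radialMass t‖ * ‖t‖ ^ α) * M)
    simpa using this
  refine squeeze_zero (fun _ => norm_nonneg _) (fun k => ?_) hz
  have hk : (0 : ℝ) < 2 ^ k := by positivity
  set κ := dilate 2 (2 ^ k) radialMass with hκ
  have hκc : Continuous κ :=
    continuous_const.mul (continuous_radialMass.comp (continuous_const_smul _))
  have hcs : HasCompactSupport κ := hasCompactSupport_radialMass.dilate 2 hk.ne'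
  have hi : Integrable fun t => κ t • g z :=
    (hκc.smul continuous_const).integrable_of_hasCompactSupport hcs.smul_right
  have e : conv κ g z - (∫ t, radialMass t) • g z = ∫ t, κ t • (g (z - t) - g z) := by
    simp only [smul_sub]
    rw [integral_sub (integrable_conv hκc hcs hgc z) hi, integral_smul_const, hκ,
      integral_dilate 2 hk, mul_inv_cancel₀ (by positivity), Complex.ofReal_one, one_mul]
    rfl
  have hn := integral_norm_dilate_mul_rpow (κ := radialMass) (α := α) 2 hk
  rw [mul_inv_cancel₀ (by positivity), one_mul, two_pow_rpow_neg] at hn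
  rw [e, ← mul_assoc, ← hn, ← integral_mul_const]
  refine norm_integral_le_of_norm_le (Integrable.mul_const ?_ M) (ae_of_all _ fun t => ?_)
  · refine Continuous.integrable_of_hasCompactSupport ?_ hcs.norm.mul_right
    exact hκc.norm.mul (continuous_norm.rpow_const fun _ => Or.inr hα0.le)
  · rw [norm_smul, mul_assoc, mul_comm _ M]
    gcongr
    simpa using hg.2 (z - t) trivial z trivial

variable [IsScalarTower ℝ ℂ E]

theorem conv_add_mul_left (hκ : Continuous κ) (hc : HasCompactSupport κ) (hκ' : Continuous κ')
    (hc' : HasCompactSupport κ') (hg : Continuous g) (a z : ℂ) :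
    conv (fun t => κ t + a * κ' t) g z = conv κ g z + a • conv κ' g z := by
  have hi : Integrable fun t => a • κ' t • g (z - t) := (integrable_conv hκ' hc' hg z).smul a
  unfold conv
  rw [← integral_smul, ← integral_add (integrable_conv hκ hc hg z) hi]
  simp only [add_smul, mul_smul]

/-- The dilates of a kernel of mean zero sum up to a bounded operator of Hölder spaces. -/
theorem exists_holderBound_tsum_conv [CompleteSpace E] (hα0 : 0 < α) (hα1 : α < 1)
    (hκ : ContDiff ℝ 1 κ) (hc : HasCompactSupport κ) (h0 : ∫ t, κ t = 0) :
    ∃ C, 0 ≤ C ∧ ∀ (g : ℂ → E) (M : ℝ), 0 ≤ M → HolderBound α univ M g →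
      (∀ k z, ‖conv (dilate 2 (2 ^ k) κ) g z‖ ≤ C * M * ((2 : ℝ) ^ (-α)) ^ k) ∧
      HolderBound α univ (C * M) (fun z => ∑' k : ℕ, conv (dilate 2 (2 ^ k) κ) g z) := by
  obtain ⟨C, hC, hsum⟩ := exists_holderBound_tsum (E := E) hα0 hα1
  set N : (ℂ → ℂ) → ℝ := fun κ => ∫ t, ‖κ t‖ * ‖t‖ ^ α with hN
  have hN0 : ∀ κ, 0 ≤ N κ := fun κ => integral_nonneg fun t => by positivity
  have hd0 : ∀ e, Continuous (dirDeriv e κ) := fun e => (hκ.dirDeriv (m := 0) (by simp) e).continuous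
  set A := N κ + 2 * (N (dirDeriv 1 κ) + N (dirDeriv Complex.I κ)) with hA
  have h1 := hN0 κ
  have h2 := hN0 (dirDeriv 1 κ)
  have h3 := hN0 (dirDeriv Complex.I κ)
  have hA0 : 0 ≤ A := by positivity
  refine ⟨(C + 1) * A, by positivity, fun g M hM hg => ?_⟩
  have hgc := hg.continuous hα0
  have hsize : ∀ (k : ℕ) z, ‖conv (dilate 2 (2 ^ k) κ) g z‖ ≤ A * M * ((2 : ℝ) ^ (-α)) ^ k := by
    intro k z
    have hk : (0 : ℝ) < 2 ^ k := by positivity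
    refine (norm_conv_le_of_integral_eq_zero (hκ.dilate 2 _).continuous (hc.dilate 2 hk.ne')
      (by rw [integral_dilate 2 hk, h0, mul_zero]) hα0 hg z).trans ?_
    rw [integral_norm_dilate_mul_rpow 2 hk, mul_inv_cancel₀ (by positivity), one_mul,
      two_pow_rpow_neg]
    calc _ = N κ * M * ((2 : ℝ) ^ (-α)) ^ k := by ring
      _ ≤ _ := by gcongr; linarith
  refine ⟨fun k z => (hsize k z).trans ?_, (hsum _ (A * M) (by positivity) hsize
    fun k z w => ?_).mono ?_⟩
  · gcongr
    nlinarith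
  · have hk : (0 : ℝ) < 2 ^ k := by positivity
    have hder : ∀ e : ℂ, (N (dirDeriv e κ) ≤ N (dirDeriv 1 κ) + N (dirDeriv Complex.I κ)) → ∀ z,
        ‖conv (dirDeriv e (dilate 2 (2 ^ k) κ)) g z‖
          ≤ (N (dirDeriv 1 κ) + N (dirDeriv Complex.I κ)) * M * (2 * (2 : ℝ) ^ (-α)) ^ k := by
      intro e he z
      rw [dirDeriv_dilate (hκ.differentiable one_ne_zero)]
      refine (norm_conv_le_of_integral_eq_zero ((hκ.dirDeriv (m := 0) (by simp) e).dilate 3 _).continuous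
        ((hc.dirDeriv e).dilate 3 hk.ne')
        (by rw [integral_dilate 3 hk, integral_dirDeriv hκ hc, mul_zero]) hα0 hg z).trans ?_
      rw [integral_norm_dilate_mul_rpow 3 hk, two_pow_rpow_neg, mul_pow]
      have : ((2 : ℝ) ^ k) ^ 3 * (((2 : ℝ) ^ k) ^ 2)⁻¹ = 2 ^ k := by field_simp
      rw [this]
      calc _ = N (dirDeriv e κ) * M * (2 ^ k * ((2 : ℝ) ^ (-α)) ^ k) := by ring
        _ ≤ _ := by gcongr
    refine (norm_conv_sub_conv_le (hκ.dilate 2 _) (hc.dilate 2 hk.ne') hgc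
      (hder 1 (by linarith)) (hder Complex.I (by linarith)) z w).trans ?_
    calc _ = 2 * (N (dirDeriv 1 κ) + N (dirDeriv Complex.I κ)) * M * (2 * (2 : ℝ) ^ (-α)) ^ k
          * ‖z - w‖ := by ring
      _ ≤ _ := by gcongr; linarith
  · nlinarith [mul_nonneg hA0 hM]

/-- The convolution with the Cauchy kernel `1 / w`, cut off by `radialCutoff`, as a sum of
convolutions with the dyadic pieces of the kernel. Up to a constant factor it inverts
`∂₁ + i ∂ᵢ`. -/
noncomputable def cauchySum (g : ℂ → E) (z : ℂ) : E :=
  ∑' k : ℕ, conv (dilate 1 (2 ^ k) cauchyPiece) g z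

/-- The derivative of `cauchySum g` in the direction `e`. -/
noncomputable def cauchySumDeriv (e : ℂ) (g : ℂ → E) (z : ℂ) : E :=
  ∑' k : ℕ, conv (dilate 2 (2 ^ k) (dirDeriv e cauchyPiece)) g z

theorem contDiff_dirDeriv_cauchyPiece (e : ℂ) {n : ℕ∞} : ContDiff ℝ n (dirDeriv e cauchyPiece) :=
  (contDiff_cauchyPiece (n := n + 1)).dirDeriv (by simp) e

/-- The truncated Cauchy transform maps bounded functions to Hölder functions. The `k`-th term of
its series has size `2 ^ (-k)` and a Lipschitz constant independent of `k`, so that the cancellation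
used for its derivatives is not needed. -/
theorem exists_holderBound_cauchySum [CompleteSpace E] (hα0 : 0 < α) (hα1 : α < 1) :
    ∃ C, 0 ≤ C ∧ ∀ (g : ℂ → E) (M : ℝ), 0 ≤ M → Continuous g → (∀ z, ‖g z‖ ≤ M) →
      (∀ k z, ‖conv (dilate 1 (2 ^ k) cauchyPiece) g z‖ ≤ C * M * ((2 : ℝ) ^ (-α)) ^ k) ∧
      HolderBound α univ (C * M) (cauchySum g) := by
  obtain ⟨C, hC, hsum⟩ := exists_holderBound_tsum (E := E) hα0 hα1
  set N : (ℂ → ℂ) → ℝ := fun κ => ∫ t, ‖κ t‖ with hN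
  have hN0 : ∀ κ, 0 ≤ N κ := fun κ => integral_nonneg fun t => norm_nonneg _
  set A := N cauchyPiece
    + 2 * (N (dirDeriv 1 cauchyPiece) + N (dirDeriv Complex.I cauchyPiece)) with hA
  have h1 := hN0 cauchyPiece
  have h2 := hN0 (dirDeriv 1 cauchyPiece)
  have h3 := hN0 (dirDeriv Complex.I cauchyPiece)
  have hA0 : 0 ≤ A := by positivity
  have hκ : ContDiff ℝ 1 cauchyPiece := contDiff_cauchyPiece (n := 1)
  have hc := hasCompactSupport_cauchyPiece
  have hq : (2 : ℝ)⁻¹ ≤ (2 : ℝ) ^ (-α) := by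
    rw [← Real.rpow_neg_one]
    exact Real.rpow_le_rpow_of_exponent_le one_le_two (by linarith)
  refine ⟨(C + 1) * A, by positivity, fun g M hM hgc hg => ?_⟩
  have hsize : ∀ (k : ℕ) z,
      ‖conv (dilate 1 (2 ^ k) cauchyPiece) g z‖ ≤ A * M * ((2 : ℝ) ^ (-α)) ^ k := by
    intro k z
    have hk : (0 : ℝ) < 2 ^ k := by positivity
    refine (norm_conv_le (hκ.dilate 1 _).continuous (hc.dilate 1 hk.ne') hg z).trans ?_
    rw [integral_norm_dilate 1 hk]
    have : ((2 : ℝ) ^ k) ^ 1 * (((2 : ℝ) ^ k) ^ 2)⁻¹ = 2⁻¹ ^ k := by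
      rw [inv_pow]
      field_simp
    rw [this]
    calc _ = N cauchyPiece * M * 2⁻¹ ^ k := by ring
      _ ≤ _ := by gcongr; linarith
  refine ⟨fun k z => (hsize k z).trans ?_, (hsum _ (A * M) (by positivity) hsize
    fun k z w => ?_).mono ?_⟩
  · gcongr
    nlinarith
  · have hk : (0 : ℝ) < 2 ^ k := by positivity
    have hder : ∀ e : ℂ,
        (N (dirDeriv e cauchyPiece) ≤ N (dirDeriv 1 cauchyPiece) + N (dirDeriv Complex.I cauchyPiece))
        → ∀ z, ‖conv (dirDeriv e (dilate 1 (2 ^ k) cauchyPiece)) g z‖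
          ≤ (N (dirDeriv 1 cauchyPiece) + N (dirDeriv Complex.I cauchyPiece)) * M := by
      intro e he z
      rw [dirDeriv_dilate (hκ.differentiable one_ne_zero)]
      refine (norm_conv_le ((hκ.dirDeriv (m := 0) (by simp) e).dilate 2 _).continuous
        ((hc.dirDeriv e).dilate 2 hk.ne') hg z).trans ?_
      rw [integral_norm_dilate 2 hk, mul_inv_cancel₀ (by positivity), one_mul]
      gcongr
    refine (norm_conv_sub_conv_le (hκ.dilate 1 _) (hc.dilate 1 hk.ne') hgc
      (hder 1 (by linarith)) (hder Complex.I (by linarith)) z w).trans ?_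
    have h1k : 1 ≤ (2 * (2 : ℝ) ^ (-α)) ^ k := one_le_pow₀ (by linarith)
    calc _ = 2 * (N (dirDeriv 1 cauchyPiece) + N (dirDeriv Complex.I cauchyPiece)) * M * 1
          * ‖z - w‖ := by ring
      _ ≤ A * M * (2 * (2 : ℝ) ^ (-α)) ^ k * ‖z - w‖ := by gcongr; linarith
  · nlinarith [mul_nonneg hA0 hM]

theorem summable_pow_two_rpow_neg (hα0 : 0 < α) (C : ℝ) :
    Summable fun k : ℕ => C * ((2 : ℝ) ^ (-α)) ^ k :=
  (summable_geometric_of_lt_one (by positivity)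
    (Real.rpow_lt_one_of_one_lt_of_neg one_lt_two (by linarith))).mul_left C

/-- The truncated Cauchy transform maps `C^{0,α}` to `C^{1,α}`. -/
theorem exists_holderBound_cauchySumDeriv [CompleteSpace E] (hα0 : 0 < α) (hα1 : α < 1) :
    ∃ C, 0 ≤ C ∧ ∀ (g : ℂ → E) (M : ℝ), 0 ≤ M → HolderBound α univ M g →
      (∃ D : ℂ → ℂ →L[ℝ] E, (∀ z, HasFDerivAt (cauchySum g) (D z) z) ∧
        ∀ e z, D z e = cauchySumDeriv e g z) ∧
      HolderBound α univ (C * M) (cauchySumDeriv 1 g) ∧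
      HolderBound α univ (C * M) (cauchySumDeriv Complex.I g) := by
  have hκ : ContDiff ℝ 1 cauchyPiece := contDiff_cauchyPiece (n := 1)
  have hc := hasCompactSupport_cauchyPiece
  have hb := fun e => exists_holderBound_tsum_conv (E := E) hα0 hα1
    (contDiff_dirDeriv_cauchyPiece e (n := 1)) (hc.dirDeriv e) (integral_dirDeriv hκ hc e)
  obtain ⟨C1, hC1, h1⟩ := hb 1
  obtain ⟨C2, hC2, h2⟩ := hb Complex.I
  obtain ⟨C0, hC0, h0⟩ := exists_holderBound_cauchySum (E := E) hα0 hα1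
  refine ⟨C1 + C2, by positivity, fun g M hM hg => ?_⟩
  have hgc := hg.continuous hα0
  refine ⟨?_, ((h1 g M hM hg).2).mono (by nlinarith), ((h2 g M hM hg).2).mono (by nlinarith)⟩
  have hk : ∀ k : ℕ, ((2 : ℝ) ^ k) ≠ 0 := fun k => by positivity
  choose D hD hDe using fun (k : ℕ) (z : ℂ) =>
    hasFDerivAt_conv (hκ.dilate 1 (2 ^ k)) (hc.dilate 1 (hk k)) hgc z
  have hDe' : ∀ k z e, D k z e = conv (dilate 2 (2 ^ k) (dirDeriv e cauchyPiece)) g z := by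
    intro k z e
    rw [hDe, dirDeriv_dilate (hκ.differentiable one_ne_zero)]
  have hDn : ∀ k z, ‖D k z‖ ≤ (C1 + C2) * M * ((2 : ℝ) ^ (-α)) ^ k := by
    intro k z
    rw [add_mul, add_mul]
    refine opNorm_le_of_apply ?_ ?_
    · rw [hDe']
      exact (h1 g M hM hg).1 k z
    · rw [hDe']
      exact (h2 g M hM hg).1 k z
  have hs := summable_pow_two_rpow_neg hα0 ((C1 + C2) * M)
  refine ⟨fun z => ∑' k, D k z, fun z => ?_, fun e z => ?_⟩
  · exact hasFDerivAt_tsum hs hD hDn (x₀ := 0) (Summable.of_norm_bounded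
      (summable_pow_two_rpow_neg hα0 (C0 * M)) fun k => (h0 g M hM hgc fun z => hg.1 z trivial).1 k 0) z
  · have := (ContinuousLinearMap.apply ℝ E e).map_tsum (Summable.of_norm_bounded hs fun k => hDn k z)
    simp only [ContinuousLinearMap.apply_apply] at this
    rw [this]
    exact tsum_congr fun k => hDe' k z e

theorem summable_cauchySumDeriv [CompleteSpace E] (hα0 : 0 < α) (hα1 : α < 1) (hM : 0 ≤ M)
    (hg : HolderBound α univ M g) (e z : ℂ) :
    Summable fun k : ℕ => conv (dilate 2 (2 ^ k) (dirDeriv e cauchyPiece)) g z := by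
  have hc := hasCompactSupport_cauchyPiece
  obtain ⟨C1, hC1, h1⟩ := exists_holderBound_tsum_conv (E := E) hα0 hα1
    (contDiff_dirDeriv_cauchyPiece e (n := 1)) (hc.dirDeriv e)
    (integral_dirDeriv (contDiff_cauchyPiece (n := 1)) hc e)
  exact Summable.of_norm_bounded (summable_pow_two_rpow_neg hα0 (C1 * M)) fun k =>
    (h1 g M hM hg).1 k z

theorem summable_cauchySum [CompleteSpace E] (hg : Continuous g) (hM : 0 ≤ M)
    (h : ∀ z, ‖g z‖ ≤ M) (z : ℂ) :
    Summable fun k : ℕ => conv (dilate 1 (2 ^ k) cauchyPiece) g z := by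
  obtain ⟨C, _, hC⟩ := exists_holderBound_cauchySum (E := E) one_half_pos one_half_lt_one
  exact Summable.of_norm_bounded (summable_pow_two_rpow_neg one_half_pos (C * M)) fun k =>
    (hC g M hM hg h).1 k z

/-- `cauchySum` inverts a multiple of `∂₁ + i ∂ᵢ` near the support of its argument: by
`dbar_cauchyPiece` the series telescopes to the limit of an approximate identity. -/
theorem dbar_cauchySum [CompleteSpace E] (hα0 : 0 < α) (hα1 : α < 1) (hM : 0 ≤ M)
    (hg : HolderBound α univ M g) (hsupp : ∀ w, 3 < ‖w‖ → g w = 0) {z : ℂ} (hz : ‖z‖ ≤ 3) :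
    cauchySumDeriv 1 g z + Complex.I • cauchySumDeriv Complex.I g z
      = (∫ t, radialMass t) • g z := by
  have hgc := hg.continuous hα0
  have hcp := hasCompactSupport_cauchyPiece
  have h1 := summable_cauchySumDeriv hα0 hα1 hM hg 1 z
  have h2 := (summable_cauchySumDeriv hα0 hα1 hM hg Complex.I z).const_smul Complex.I
  have hsum := (h1.add h2).hasSum.tendsto_sum_nat
  rw [h1.tsum_add h2, (summable_cauchySumDeriv hα0 hα1 hM hg Complex.I z).tsum_const_smul] at hsum
  refine tendsto_nhds_unique hsum ?_
  set a : ℕ → E := fun k => conv (dilate 2 (2 ^ k) radialMass) g z with ha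
  have hterm : ∀ k : ℕ, conv (dilate 2 (2 ^ k) (dirDeriv 1 cauchyPiece)) g z
      + Complex.I • conv (dilate 2 (2 ^ k) (dirDeriv Complex.I cauchyPiece)) g z
      = a (k + 1) - a k := by
    intro k
    have hk : ∀ k : ℕ, ((2 : ℝ) ^ k) ≠ 0 := fun k => by positivity
    have c1 := fun e => ((contDiff_dirDeriv_cauchyPiece e (n := 0)).dilate 2 (2 ^ k)).continuous
    have c2 := fun e => (hcp.dirDeriv e).dilate 2 (hk k)
    have c3 : ∀ k : ℕ, Continuous (dilate 2 (2 ^ k) radialMass) := fun k =>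
      continuous_const.mul (continuous_radialMass.comp (continuous_const_smul _))
    have c4 : ∀ k : ℕ, HasCompactSupport (dilate 2 (2 ^ k) radialMass) := fun k =>
      hasCompactSupport_radialMass.dilate 2 (hk k)
    rw [← conv_add_mul_left (c1 1) (c2 1) (c1 Complex.I) (c2 Complex.I) hgc, sub_eq_add_neg,
      ← neg_one_smul ℂ (a k), ← conv_add_mul_left (c3 _) (c4 _) (c3 _) (c4 _) hgc]
    congr 1
    funext t
    have := dbar_cauchyPiece ((2 ^ k : ℝ) • t)
    simp only [dilate] at this ⊢
    rw [smul_smul, ← pow_succ'] at this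
    push_cast at *
    linear_combination (2 ^ k) ^ 2 * this
  -- the mass lives at distance at least `8`, the points of the disc of radius `3` at most at `6`
  have ha0 : a 0 = 0 := by
    refine integral_eq_zero_of_ae (ae_of_all _ fun t => ?_)
    simp only [dilate, pow_zero, one_pow, Complex.ofReal_one, one_mul, one_smul, Pi.zero_apply]
    rcases lt_or_ge ‖t‖ 8 with ht | ht
    · rw [radialMass_of_norm_lt ht, zero_smul]
    · rw [hsupp, smul_zero]
      have := norm_sub_norm_le t z
      rw [norm_sub_rev] at this
      linarith
  simp only [hterm, Finset.sum_range_sub, ha0, sub_zero]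
  exact tendsto_conv_radialMass hα0 hg z

theorem integrable_inv_norm_mul_exp {b : ℝ} (hb : 0 < b) :
    Integrable fun t : ℂ => ‖t‖⁻¹ * Real.exp (-b * ‖t‖ ^ 2) := by
  -- otherwise the integral would have the value `0`, while the Gamma function gives it a positive one
  by_contra h
  have h1 := Complex.integral_rpow_mul_exp_neg_mul_rpow (p := 2) (q := -1) one_le_two (by norm_num) hb
  have h2 : (fun t : ℂ => ‖t‖ ^ (-1 : ℝ) * Real.exp (-b * ‖t‖ ^ (2 : ℝ)))
      = fun t : ℂ => ‖t‖⁻¹ * Real.exp (-b * ‖t‖ ^ 2) := by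
    funext t
    rw [Real.rpow_neg_one, Real.rpow_two]
  rw [h2, integral_undef h] at h1
  have : 0 < (2 * Real.pi / 2) * b ^ (-(-1 + 2 : ℝ) / 2) * Real.Gamma ((-1 + 2 : ℝ) / 2) := by
    have := Real.Gamma_pos_of_pos (s := (-1 + 2 : ℝ) / 2) (by norm_num)
    positivity
  linarith

theorem tendsto_integral_inv_norm_mul_exp :
    Tendsto (fun b : ℝ => ∫ t : ℂ, ‖t‖⁻¹ * Real.exp (-b * ‖t‖ ^ 2)) atTop (𝓝 0) := by
  have h1 : (fun b : ℝ => (2 * Real.pi / 2) * b ^ (-(1 / 2 : ℝ)) * Real.Gamma ((-1 + 2 : ℝ) / 2))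
      =ᶠ[atTop] fun b : ℝ => ∫ t : ℂ, ‖t‖⁻¹ * Real.exp (-b * ‖t‖ ^ 2) := by
    filter_upwards [eventually_gt_atTop 0] with b hb
    have h1 := Complex.integral_rpow_mul_exp_neg_mul_rpow (p := 2) (q := -1) one_le_two
      (by norm_num) hb
    have h2 : (fun t : ℂ => ‖t‖ ^ (-1 : ℝ) * Real.exp (-b * ‖t‖ ^ (2 : ℝ)))
        = fun t : ℂ => ‖t‖⁻¹ * Real.exp (-b * ‖t‖ ^ 2) := by
      funext t
      rw [Real.rpow_neg_one, Real.rpow_two]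
    rw [h2] at h1
    rw [h1]
    norm_num
  refine Tendsto.congr' h1 ?_
  have := ((tendsto_rpow_neg_atTop (y := 1 / 2) (by norm_num)).const_mul (2 * Real.pi / 2)).mul_const
    (Real.Gamma ((-1 + 2 : ℝ) / 2))
  simpa using this

/-- The integral formula for `cauchySum`. -/
theorem cauchySum_eq_integral [CompleteSpace E] (hg : Continuous g) (hM : 0 ≤ M)
    (h : ∀ z, ‖g z‖ ≤ M) (z : ℂ) :
    cauchySum g z = ∫ t, (radialCutoff t / t) • g (z - t) := by
  have hsum := (summable_cauchySum hg hM h z).hasSum.tendsto_sum_nat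
  refine tendsto_nhds_unique hsum ?_
  have hk : ∀ k : ℕ, ((2 : ℝ) ^ k) ≠ 0 := fun k => by positivity
  have htel : ∀ (K : ℕ) (t : ℂ), ∑ k ∈ Finset.range K, dilate 1 (2 ^ k) cauchyPiece t
      = (radialCutoff t - radialCutoff ((2 ^ K : ℝ) • t)) / t := by
    intro K t
    induction K with
    | zero => simp
    | succ K ih =>
      rw [Finset.sum_range_succ, ih, dilate, cauchyPiece, smul_smul, ← pow_succ']
      rcases eq_or_ne t 0 with rfl | ht
      · simp
      · have : ((2 ^ K : ℝ) : ℂ) ≠ 0 := by exact_mod_cast hk K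
        rw [Complex.real_smul (x := 2 ^ K)]
        field_simp
        push_cast
        ring
  have hpart : ∀ K : ℕ, ∑ k ∈ Finset.range K, conv (dilate 1 (2 ^ k) cauchyPiece) g z
      = ∫ t, ((radialCutoff t - radialCutoff ((2 ^ K : ℝ) • t)) / t) • g (z - t) := by
    intro K
    unfold conv
    rw [← integral_finsetSum]
    · simp only [← Finset.sum_smul, htel]
    · exact fun k _ => integrable_conv ((contDiff_cauchyPiece (n := 0)).dilate 1 _).continuous
        (hasCompactSupport_cauchyPiece.dilate 1 (hk k)) hg z
  simp only [hpart]
  refine tendsto_integral_of_dominated_convergence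
    (fun t => 2 * M * Real.exp 144 * (‖t‖⁻¹ * Real.exp (-1 * ‖t‖ ^ 2))) (fun K => ?_)
    ((integrable_inv_norm_mul_exp one_pos).const_mul _) (fun K => ae_of_all _ fun t => ?_) ?_
  · have hm : Measurable fun t : ℂ => (radialCutoff t - radialCutoff ((2 ^ K : ℝ) • t)) / t := by
      have hc : Continuous radialCutoff := (contDiff_radialCutoff (n := 0)).continuous
      exact (hc.sub (hc.comp (continuous_const_smul _))).measurable.div measurable_id
    exact hm.aestronglyMeasurable.smul (hg.comp (continuous_const.sub continuous_id)).aestronglyMeasurable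
  · rw [norm_smul, norm_div]
    rcases le_or_gt ‖t‖ 12 with ht | ht
    · have h2 : ‖radialCutoff t - radialCutoff ((2 ^ K : ℝ) • t)‖ ≤ 2 :=
        (norm_sub_le _ _).trans ((add_le_add (norm_radialCutoff_le _) (norm_radialCutoff_le _)).trans
          (by norm_num))
      have h3 : 1 ≤ Real.exp 144 * Real.exp (-1 * ‖t‖ ^ 2) := by
        rw [← Real.exp_add]
        exact Real.one_le_exp (by nlinarith [norm_nonneg t])
      calc _ ≤ 2 / ‖t‖ * M := by gcongr; exact h _
        _ = 2 * M * ‖t‖⁻¹ * 1 := by ring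
        _ ≤ 2 * M * ‖t‖⁻¹ * (Real.exp 144 * Real.exp (-1 * ‖t‖ ^ 2)) := by gcongr
        _ = _ := by ring
    · have h4 : 12 ≤ ‖(2 ^ K : ℝ) • t‖ := by
        rw [norm_smul, norm_pow, Real.norm_two]
        have : (1 : ℝ) ≤ 2 ^ K := one_le_pow₀ one_le_two
        nlinarith
      rw [radialCutoff_of_le_norm ht.le, radialCutoff_of_le_norm h4]
      simp only [sub_self, norm_zero, zero_div, zero_mul]
      positivity
  · have hne : ∀ᵐ t : ℂ, t ≠ 0 := by
      simp [ae_iff]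
    filter_upwards [hne] with t ht
    refine tendsto_const_nhds.congr' ?_
    have hlim : Tendsto (fun K : ℕ => (2 : ℝ) ^ K * ‖t‖) atTop atTop :=
      (tendsto_pow_atTop_atTop_of_one_lt one_lt_two).atTop_mul_const (norm_pos_iff.2 ht)
    filter_upwards [hlim.eventually_ge_atTop 12] with K hK
    rw [radialCutoff_of_le_norm (w := (2 ^ K : ℝ) • t) (by
      rwa [norm_smul, norm_pow, Real.norm_two]), sub_zero]

end CauchyTransform

/-! ### The Fock kernel -/

section FockKernel

variable {E : Type*} [NormedAddCommGroup E] {α M : ℝ} {g g' : ℂ → E}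

theorem hasCompactSupport_of_forall (hsupp : ∀ w, 3 < ‖w‖ → g w = 0) : HasCompactSupport g :=
  HasCompactSupport.of_support_subset_isCompact (isCompact_closedBall (0 : ℂ) 3) fun w hw => by
    by_contra h
    exact hw (hsupp w (by simpa using h))

variable [NormedSpace ℂ E]

/-- The entire function `(eˣ - 1) / x`. -/
noncomputable def expQuot : ℂ → ℂ := dslope Complex.exp 0

theorem mul_expQuot (x : ℂ) : x * expQuot x = Complex.exp x - 1 := by
  have := sub_smul_dslope Complex.exp 0 x
  simpa [expQuot] using this

theorem differentiable_expQuot : Differentiable ℂ expQuot := by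
  rw [← differentiableOn_univ]
  exact (Complex.differentiableOn_dslope univ_mem).2 Complex.differentiable_exp.differentiableOn

/-- The difference, holomorphic in `z`, of the Fock kernel `exp (2 b (z - w) w̄) / (z - w)` and
of the Cauchy kernel `1 / (z - w)`. -/
noncomputable def fockDiff (b : ℝ) (z w : ℂ) : ℂ :=
  2 * b * starRingEnd ℂ w * expQuot (2 * b * (z - w) * starRingEnd ℂ w)

/-- The derivative of `fockDiff` in its first variable. -/
noncomputable def fockDiffDeriv (b : ℝ) (z w : ℂ) : ℂ :=
  (2 * b * starRingEnd ℂ w) ^ 2 * deriv expQuot (2 * b * (z - w) * starRingEnd ℂ w)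

theorem hasDerivAt_fockDiff (b : ℝ) (z w : ℂ) :
    HasDerivAt (fun z => fockDiff b z w) (fockDiffDeriv b z w) z := by
  have h1 : HasDerivAt (fun z => 2 * b * (z - w) * starRingEnd ℂ w) (2 * b * starRingEnd ℂ w) z := by
    simpa using (((hasDerivAt_id z).sub_const w).const_mul (2 * b : ℂ)).mul_const (starRingEnd ℂ w)
  have h2 := ((differentiable_expQuot _).hasDerivAt.comp z h1).const_mul (2 * b * starRingEnd ℂ w)
  refine h2.congr_deriv ?_
  rw [fockDiffDeriv]
  ring

theorem contDiff_comp_fock_exponent (b : ℝ) {f : ℂ → ℂ} (hf : Differentiable ℂ f) :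
    ContDiff ℝ 1 fun p : ℂ × ℂ => f (2 * b * (p.1 - p.2) * starRingEnd ℂ p.2) := by
  have hc : ContDiff ℝ 1 fun p : ℂ × ℂ => starRingEnd ℂ p.2 :=
    Complex.conjCLE.contDiff.comp contDiff_snd
  exact (hf.contDiff.restrict_scalars ℝ).comp
    ((contDiff_const.mul (contDiff_fst.sub contDiff_snd)).mul hc)

theorem contDiff_fockDiff (b : ℝ) : ContDiff ℝ 1 fun p : ℂ × ℂ => fockDiff b p.1 p.2 :=
  (contDiff_const.mul (Complex.conjCLE.contDiff.comp contDiff_snd)).mul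
    (contDiff_comp_fock_exponent b differentiable_expQuot)

theorem contDiff_fockDiffDeriv (b : ℝ) : ContDiff ℝ 1 fun p : ℂ × ℂ => fockDiffDeriv b p.1 p.2 :=
  ((contDiff_const.mul (Complex.conjCLE.contDiff.comp contDiff_snd)).pow 2).mul
    (contDiff_comp_fock_exponent b differentiable_expQuot.deriv)

theorem integrable_kernel_smul {K : ℂ → ℂ → ℂ} (hK : Continuous fun p : ℂ × ℂ => K p.1 p.2)
    (hg : Continuous g) (hsupp : ∀ w, 3 < ‖w‖ → g w = 0) (z : ℂ) :
    Integrable fun w => K z w • g w :=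
  Continuous.integrable_of_hasCompactSupport
    ((hK.comp (continuous_const.prodMk continuous_id)).smul hg)
    (hasCompactSupport_of_forall hsupp).smul_left

variable [NormedSpace ℝ E]

/-- An integral operator with a `C¹` kernel maps bounded functions to Hölder functions. -/
theorem exists_holderBound_integral {K : ℂ → ℂ → ℂ} (hK : ContDiff ℝ 1 fun p : ℂ × ℂ => K p.1 p.2)
    (hα0 : 0 < α) (hα1 : α < 1) : ∃ C, 0 ≤ C ∧ ∀ (g : ℂ → E) (N : ℝ), 0 ≤ N → Continuous g →
      (∀ w, 3 < ‖w‖ → g w = 0) → (∀ w, ‖g w‖ ≤ N) →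
      HolderBound α (Metric.closedBall 0 3) (C * N) (fun z => ∫ w, K z w • g w) := by
  obtain ⟨C, hC, h1, h2⟩ := exists_bound_lipschitz_of_contDiff hK 3
  set v := volume.real (Metric.closedBall (0 : ℂ) 3) with hv
  have hv0 : 0 ≤ v := measureReal_nonneg
  have hvfin : volume (Metric.closedBall (0 : ℂ) 3) < ⊤ := measure_closedBall_lt_top
  have hint : ∀ (B : ℝ) (f : ℂ → E), (∀ w, 3 < ‖w‖ → f w = 0) → (∀ w, ‖w‖ ≤ 3 → ‖f w‖ ≤ B) →
      ‖∫ w, f w‖ ≤ B * v := by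
    intro B f hf hB
    rw [← setIntegral_eq_integral_of_forall_compl_eq_zero (s := Metric.closedBall (0 : ℂ) 3)
      fun w hw => hf w (by simpa using hw)]
    exact norm_setIntegral_le_of_norm_le_const hvfin fun w hw => hB w (by simpa using hw)
  have hp : ∀ {z w : ℂ}, ‖z‖ ≤ 3 → ‖w‖ ≤ 3 → ‖((z, w) : ℂ × ℂ)‖ ≤ 3 := fun hz hw =>
    norm_prod_le_iff.2 ⟨hz, hw⟩
  refine ⟨2 * (C * v), by positivity, fun g N hN hgc hsupp hg => ?_⟩
  have := holderBound_of_lipschitz (S := Metric.closedBall (0 : ℂ) 3) (M := C * v * N)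
    (f := fun z => ∫ w, K z w • g w) hα0 hα1 (by positivity) (fun z hz => ?_) (fun z hz z' hz' => ?_)
  · exact this.mono (le_of_eq (by ring))
  · refine (hint (C * N) _ (fun w hw => by rw [hsupp w hw, smul_zero]) fun w hw => ?_).trans
      (le_of_eq (by ring))
    rw [norm_smul]
    exact mul_le_mul (h1 (z, w) (hp (by simpa using hz) hw)) (hg w) (norm_nonneg _) hC
  · rw [← integral_sub (integrable_kernel_smul hK.continuous hgc hsupp z)
      (integrable_kernel_smul hK.continuous hgc hsupp z')]
    refine (hint (C * ‖z - z'‖ * N) _ (fun w hw => by simp [hsupp w hw]) fun w hw => ?_).trans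
      (le_of_eq (by ring))
    rw [← sub_smul, norm_smul]
    refine mul_le_mul ?_ (hg w) (norm_nonneg _) (by positivity)
    have := h2 (z, w) (z', w) (hp (by simpa using hz) hw) (hp (by simpa using hz') hw)
    simpa [Prod.norm_def] using this

theorem hasDerivAt_integral_fockDiff (b : ℝ) (hg : Continuous g)
    (hsupp : ∀ w, 3 < ‖w‖ → g w = 0) (z : ℂ) :
    HasDerivAt (fun z => ∫ w, fockDiff b z w • g w) (∫ w, fockDiffDeriv b z w • g w) z := by
  obtain ⟨C, hC, h1, -⟩ := exists_bound_lipschitz_of_contDiff (contDiff_fockDiffDeriv b) (‖z‖ + 4)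
  have hi := fun z => integrable_kernel_smul (contDiff_fockDiff b).continuous hg hsupp z
  have hi' := fun z => integrable_kernel_smul (contDiff_fockDiffDeriv b).continuous hg hsupp z
  refine (hasDerivAt_integral_of_dominated_loc_of_deriv_le (Metric.ball_mem_nhds z one_pos)
    (Eventually.of_forall fun z => (hi z).aestronglyMeasurable) (hi z)
    (hi' z).aestronglyMeasurable (bound := fun w => C * ‖g w‖) (ae_of_all _ fun w x hx => ?_) ?_
    (ae_of_all _ fun w x _ => (hasDerivAt_fockDiff b x w).smul_const _)).2
  · rcases lt_or_ge 3 ‖w‖ with hw | hw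
    · simp [hsupp w hw]
    · rw [norm_smul]
      gcongr
      refine h1 (x, w) (norm_prod_le_iff.2 ⟨?_, by linarith [norm_nonneg z]⟩)
      have h3 : ‖x - z‖ < 1 := by simpa [dist_eq_norm] using hx
      have h4 := norm_sub_norm_le x z
      simp only
      linarith
  · exact ((hg.integrable_of_hasCompactSupport (hasCompactSupport_of_forall hsupp)).norm).const_mul C

/-- A right inverse of `∂₁ + i ∂ᵢ` near the disc: the Fock kernel divided by the mass of the
approximate identity of `cauchySum`. -/
noncomputable def dbarInv (b : ℝ) (g : ℂ → E) (z : ℂ) : E :=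
  (∫ t, radialMass t)⁻¹ • (cauchySum g z + ∫ w, fockDiff b z w • g w)

/-- The derivative of `dbarInv b g` in the direction `e`. -/
noncomputable def dbarInvDeriv (b : ℝ) (e : ℂ) (g : ℂ → E) (z : ℂ) : E :=
  (∫ t, radialMass t)⁻¹ • (cauchySumDeriv e g z + e • ∫ w, fockDiffDeriv b z w • g w)

theorem integral_radialMass_ne_zero : ∫ t, radialMass t ≠ 0 := by
  obtain ⟨c, hc, h⟩ := exists_integral_radialMass
  rw [h]
  exact_mod_cast hc.ne'

/-- In the norm with weight `exp (-b |z|²)`, the Fock kernel is dominated by the convolution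
kernel `|t|⁻¹ exp (-b |t|²)`. -/
theorem norm_fock_kernel (b : ℝ) {z w : ℂ} (hzw : z ≠ w) :
    ‖1 / (z - w) + fockDiff b z w‖ * Real.exp (b * ‖w‖ ^ 2)
      = Real.exp (b * ‖z‖ ^ 2) * (‖z - w‖⁻¹ * Real.exp (-b * ‖z - w‖ ^ 2)) := by
  have hne : z - w ≠ 0 := sub_ne_zero.2 hzw
  set x := 2 * b * (z - w) * starRingEnd ℂ w with hx
  have h1 : 1 / (z - w) + fockDiff b z w = (z - w)⁻¹ * Complex.exp x := by
    have : Complex.exp x = 1 + x * expQuot x := by rw [mul_expQuot]; ring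
    rw [this, fockDiff, ← hx]
    simp only [hx]
    field_simp
  have h2 : x.re = b * ‖z‖ ^ 2 - b * ‖w‖ ^ 2 - b * ‖z - w‖ ^ 2 := by
    simp only [hx, ← Complex.normSq_eq_norm_sq, Complex.normSq_apply]
    simp
    ring
  rw [h1, norm_mul, norm_inv, Complex.norm_exp, h2, mul_assoc, ← Real.exp_add, mul_left_comm,
    ← Real.exp_add]
  congr 2
  ring

variable [CompleteSpace E] [IsScalarTower ℝ ℂ E]

/-- The weighted supremum estimate for `dbarInv`. -/
theorem norm_dbarInv_le {b : ℝ} (hb : 0 < b) (hg : Continuous g) {N : ℝ}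
    (hsupp : ∀ w, 3 < ‖w‖ → g w = 0) (hN : ∀ w, ‖g w‖ ≤ N * Real.exp (b * ‖w‖ ^ 2)) {z : ℂ}
    (hz : ‖z‖ ≤ 3) :
    ‖dbarInv b g z‖ ≤ ‖(∫ t, radialMass t)⁻¹‖
      * (∫ t : ℂ, ‖t‖⁻¹ * Real.exp (-b * ‖t‖ ^ 2)) * N * Real.exp (b * ‖z‖ ^ 2) := by
  obtain ⟨B, hB⟩ := hg.bounded_above_of_compact_support (hasCompactSupport_of_forall hsupp)
  have hB0 : 0 ≤ B := (norm_nonneg _).trans (hB 0)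
  have hgi := integrable_inv_norm_mul_exp hb
  have h1 : cauchySum g z = ∫ w, (radialCutoff (z - w) / (z - w)) • g w := by
    rw [cauchySum_eq_integral hg hB0 hB z, ← integral_sub_left_eq_self _ volume z]
    simp
  have hae : ∀ᵐ w : ℂ, w ≠ z := by simp [ae_iff]
  have hcut : ∀ w, (radialCutoff (z - w) / (z - w)) • g w = (1 / (z - w)) • g w := by
    intro w
    rcases lt_or_ge 3 ‖w‖ with hw | hw
    · simp [hsupp w hw]
    · rw [radialCutoff_of_norm_le ((norm_sub_le z w).trans (by linarith))]
  have hgz : Integrable fun w => ‖z - w‖⁻¹ * Real.exp (-b * ‖z - w‖ ^ 2) :=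
    hgi.comp_sub_left z
  have hi1 : Integrable fun w => (1 / (z - w)) • g w := by
    refine (hgz.const_mul (Real.exp (b * 36) * B)).mono' ?_ (ae_of_all _ fun w => ?_)
    · exact (measurable_const.div (measurable_const.sub measurable_id)).aestronglyMeasurable.smul
        hg.aestronglyMeasurable
    · rw [norm_smul, one_div, norm_inv]
      rcases lt_or_ge 3 ‖w‖ with hw | hw
      · simp only [hsupp w hw, norm_zero, mul_zero]
        positivity
      · have h6 : ‖z - w‖ ≤ 6 := (norm_sub_le z w).trans (by linarith)
        have h7 : 1 ≤ Real.exp (b * 36) * Real.exp (-b * ‖z - w‖ ^ 2) := by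
          rw [← Real.exp_add]
          refine Real.one_le_exp ?_
          have : ‖z - w‖ ^ 2 ≤ 36 := by nlinarith [norm_nonneg (z - w)]
          nlinarith
        calc _ ≤ ‖z - w‖⁻¹ * B * 1 := by rw [mul_one]; gcongr; exact hB w
          _ ≤ ‖z - w‖⁻¹ * B * (Real.exp (b * 36) * Real.exp (-b * ‖z - w‖ ^ 2)) := by gcongr
          _ = _ := by ring
  have hi2 := integrable_kernel_smul (contDiff_fockDiff b).continuous hg hsupp z
  have h2 : cauchySum g z + ∫ w, fockDiff b z w • g w
      = ∫ w, (1 / (z - w) + fockDiff b z w) • g w := by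
    rw [h1]
    simp only [hcut, add_smul]
    rw [integral_add hi1 hi2]
  have h3 : ‖∫ w, (1 / (z - w) + fockDiff b z w) • g w‖
      ≤ ∫ w, N * Real.exp (b * ‖z‖ ^ 2) * (‖z - w‖⁻¹ * Real.exp (-b * ‖z - w‖ ^ 2)) := by
    refine norm_integral_le_of_norm_le (hgz.const_mul _) ?_
    filter_upwards [hae] with w hw
    rw [norm_smul]
    calc _ ≤ ‖1 / (z - w) + fockDiff b z w‖ * (N * Real.exp (b * ‖w‖ ^ 2)) := by
          gcongr
          exact hN w
      _ = N * (‖1 / (z - w) + fockDiff b z w‖ * Real.exp (b * ‖w‖ ^ 2)) := by ring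
      _ = _ := by rw [norm_fock_kernel b hw.symm]; ring
  rw [integral_const_mul, integral_sub_left_eq_self
    (fun t : ℂ => ‖t‖⁻¹ * Real.exp (-b * ‖t‖ ^ 2)) volume z] at h3
  rw [dbarInv, h2, norm_smul]
  calc _ ≤ _ := mul_le_mul_of_nonneg_left h3 (norm_nonneg _)
    _ = _ := by ring

theorem hasFDerivAt_dbarInv (hα0 : 0 < α) (hα1 : α < 1) (b : ℝ) (hM : 0 ≤ M)
    (hg : HolderBound α univ M g) (hsupp : ∀ w, 3 < ‖w‖ → g w = 0) (z : ℂ) :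
    ∃ D : ℂ →L[ℝ] E, HasFDerivAt (dbarInv b g) D z ∧ ∀ e, D e = dbarInvDeriv b e g z := by
  obtain ⟨C, -, h⟩ := exists_holderBound_cauchySumDeriv (E := E) hα0 hα1
  obtain ⟨⟨D, hD, hDe⟩, -⟩ := h g M hM hg
  have h1 := (hasDerivAt_integral_fockDiff b (hg.continuous hα0) hsupp z).hasFDerivAt.restrictScalars ℝ
  refine ⟨_, ((hD z).add h1).const_smul (∫ t, radialMass t)⁻¹, fun e => ?_⟩
  simp [dbarInvDeriv, hDe]

/-- `dbarInv b` is a right inverse of `∂₁ + i ∂ᵢ`. -/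
theorem dbar_dbarInv (hα0 : 0 < α) (hα1 : α < 1) (b : ℝ) (hM : 0 ≤ M)
    (hg : HolderBound α univ M g) (hsupp : ∀ w, 3 < ‖w‖ → g w = 0) {z : ℂ} (hz : ‖z‖ ≤ 3) :
    dbarInvDeriv b 1 g z + Complex.I • dbarInvDeriv b Complex.I g z = g z := by
  have h := dbar_cauchySum hα0 hα1 hM hg hsupp hz
  unfold dbarInvDeriv
  rw [smul_comm Complex.I, ← smul_add, smul_add Complex.I, smul_smul Complex.I Complex.I,
    Complex.I_mul_I, add_add_add_comm, h, ← add_smul, add_neg_cancel, zero_smul, add_zero,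
    smul_smul, inv_mul_cancel₀ integral_radialMass_ne_zero, one_smul]

theorem dbarInv_sub (b : ℝ) (hg : Continuous g) (hg' : Continuous g')
    (hsupp : ∀ w, 3 < ‖w‖ → g w = 0) (hsupp' : ∀ w, 3 < ‖w‖ → g' w = 0) (z : ℂ) :
    dbarInv b (fun w => g w - g' w) z = dbarInv b g z - dbarInv b g' z := by
  obtain ⟨B, hB⟩ := hg.bounded_above_of_compact_support (hasCompactSupport_of_forall hsupp)
  obtain ⟨B', hB'⟩ := hg'.bounded_above_of_compact_support (hasCompactSupport_of_forall hsupp')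
  have s1 := summable_cauchySum hg ((norm_nonneg _).trans (hB 0)) hB z
  have s2 := summable_cauchySum hg' ((norm_nonneg _).trans (hB' 0)) hB' z
  have e1 : cauchySum (fun w => g w - g' w) z = cauchySum g z - cauchySum g' z := by
    unfold cauchySum
    rw [← s1.tsum_sub s2]
    exact tsum_congr fun k => conv_sub_right ((contDiff_cauchyPiece (n := 0)).dilate 1 _).continuous
      (hasCompactSupport_cauchyPiece.dilate 1 (by positivity)) hg hg' z
  have e2 : ∫ w, fockDiff b z w • (g w - g' w)
      = (∫ w, fockDiff b z w • g w) - ∫ w, fockDiff b z w • g' w := by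
    rw [← integral_sub (integrable_kernel_smul (contDiff_fockDiff b).continuous hg hsupp z)
      (integrable_kernel_smul (contDiff_fockDiff b).continuous hg' hsupp' z)]
    simp only [smul_sub]
  unfold dbarInv
  rw [e1, e2, ← smul_sub, add_sub_add_comm]

theorem dbarInvDeriv_sub {M' : ℝ} (hα0 : 0 < α) (hα1 : α < 1) (b : ℝ) (hM : 0 ≤ M) (hM' : 0 ≤ M')
    (hg : HolderBound α univ M g) (hg' : HolderBound α univ M' g')
    (hsupp : ∀ w, 3 < ‖w‖ → g w = 0) (hsupp' : ∀ w, 3 < ‖w‖ → g' w = 0) (e z : ℂ) :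
    dbarInvDeriv b e (fun w => g w - g' w) z = dbarInvDeriv b e g z - dbarInvDeriv b e g' z := by
  have hgc := hg.continuous hα0
  have hgc' := hg'.continuous hα0
  have e1 : cauchySumDeriv e (fun w => g w - g' w) z
      = cauchySumDeriv e g z - cauchySumDeriv e g' z := by
    unfold cauchySumDeriv
    rw [← (summable_cauchySumDeriv hα0 hα1 hM hg e z).tsum_sub
      (summable_cauchySumDeriv hα0 hα1 hM' hg' e z)]
    exact tsum_congr fun k => conv_sub_right
      ((contDiff_dirDeriv_cauchyPiece e (n := 0)).dilate 2 _).continuous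
      ((hasCompactSupport_cauchyPiece.dirDeriv e).dilate 2 (by positivity)) hgc hgc' z
  have e2 : ∫ w, fockDiffDeriv b z w • (g w - g' w)
      = (∫ w, fockDiffDeriv b z w • g w) - ∫ w, fockDiffDeriv b z w • g' w := by
    rw [← integral_sub (integrable_kernel_smul (contDiff_fockDiffDeriv b).continuous hgc hsupp z)
      (integrable_kernel_smul (contDiff_fockDiffDeriv b).continuous hgc' hsupp' z)]
    simp only [smul_sub]
  unfold dbarInvDeriv
  rw [e1, e2, ← smul_sub, smul_sub e, add_sub_add_comm]

/-- `dbarInv b` maps bounded functions to `C^{0,α}` functions. -/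
theorem exists_holderBound_dbarInv (E : Type*) [NormedAddCommGroup E] [NormedSpace ℂ E]
    [NormedSpace ℝ E] [CompleteSpace E] [IsScalarTower ℝ ℂ E] (hα0 : 0 < α) (hα1 : α < 1) (b : ℝ) :
    ∃ C, 0 ≤ C ∧ ∀ (g : ℂ → E) (N : ℝ), 0 ≤ N → Continuous g → (∀ w, 3 < ‖w‖ → g w = 0) →
      (∀ w, ‖g w‖ ≤ N) → HolderBound α (Metric.closedBall 0 3) (C * N) (dbarInv b g) := by
  obtain ⟨C1, hC1, h1⟩ := exists_holderBound_cauchySum (E := E) hα0 hα1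
  obtain ⟨C2, hC2, h2⟩ := exists_holderBound_integral (E := E) (contDiff_fockDiff b) hα0 hα1
  set A := ContinuousLinearMap.restrictScalars ℝ ((∫ t, radialMass t)⁻¹ • ContinuousLinearMap.id ℂ E)
  refine ⟨‖A‖ * (C1 + C2), by positivity, fun g N hN hg hsupp hgN => ?_⟩
  have := ((((h1 g N hN hg hgN).2).mono_set (subset_univ _)).add
    (h2 g N hN hg hsupp hgN)).clm_comp A
  exact this.mono (le_of_eq (by ring))

/-- The derivatives of `dbarInv b g` are bounded in `C^{0,α}` by those of `g`. -/
theorem exists_holderBound_dbarInvDeriv (E : Type*) [NormedAddCommGroup E] [NormedSpace ℂ E]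
    [NormedSpace ℝ E] [CompleteSpace E] [IsScalarTower ℝ ℂ E] (hα0 : 0 < α) (hα1 : α < 1) (b : ℝ) :
    ∃ C, 0 ≤ C ∧ ∀ (g : ℂ → E) (M : ℝ), 0 ≤ M → HolderBound α univ M g →
      (∀ w, 3 < ‖w‖ → g w = 0) →
      HolderBound α (Metric.closedBall 0 3) (C * M) (dbarInvDeriv b 1 g) ∧
      HolderBound α (Metric.closedBall 0 3) (C * M) (dbarInvDeriv b Complex.I g) := by
  obtain ⟨C1, hC1, h1⟩ := exists_holderBound_cauchySumDeriv (E := E) hα0 hα1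
  obtain ⟨C2, hC2, h2⟩ := exists_holderBound_integral (E := E) (contDiff_fockDiffDeriv b) hα0 hα1
  set L : ℂ → E →L[ℝ] E := fun a => ContinuousLinearMap.restrictScalars ℝ
    (a • ContinuousLinearMap.id ℂ E)
  set A := L (∫ t, radialMass t)⁻¹
  refine ⟨‖A‖ * (C1 + ‖L 1‖ * C2) + ‖A‖ * (C1 + ‖L Complex.I‖ * C2), by positivity,
    fun g M hM hg hsupp => ?_⟩
  obtain ⟨-, h3, h4⟩ := h1 g M hM hg
  have h5 := h2 g M hM (hg.continuous hα0) hsupp fun w => hg.1 w trivial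
  constructor
  · have := ((h3.mono_set (subset_univ _)).add (h5.clm_comp (L 1))).clm_comp A
    refine this.mono ?_
    have : 0 ≤ ‖A‖ * (C1 + ‖L Complex.I‖ * C2) * M := by positivity
    linarith
  · have := ((h4.mono_set (subset_univ _)).add (h5.clm_comp (L Complex.I))).clm_comp A
    refine this.mono ?_
    have : 0 ≤ ‖A‖ * (C1 + ‖L 1‖ * C2) * M := by positivity
    linarith

end FockKernel

/-! ### A right inverse of the Cauchy-Riemann operator of small weighted norm -/

section SolutionOperator

/-- The coordinatewise projection of the plane onto the square `[-1, 1]²`. It is `1`-Lipschitz and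
serves to continue functions from the unit disc to the plane without loss in their norms. -/
noncomputable def squareProj (z : ℂ) : ℂ :=
  ⟨projIcc (-1 : ℝ) 1 (by norm_num) z.re, projIcc (-1 : ℝ) 1 (by norm_num) z.im⟩

theorem norm_le_norm_of_abs_le {z w : ℂ} (h1 : |z.re| ≤ |w.re|) (h2 : |z.im| ≤ |w.im|) :
    ‖z‖ ≤ ‖w‖ := by
  rw [← abs_norm z, ← abs_norm w, ← sq_le_sq, ← Complex.normSq_eq_norm_sq,
    ← Complex.normSq_eq_norm_sq, Complex.normSq_apply, Complex.normSq_apply]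
  have h3 := sq_le_sq.2 h1
  have h4 := sq_le_sq.2 h2
  nlinarith

theorem norm_squareProj_sub_le (z w : ℂ) : ‖squareProj z - squareProj w‖ ≤ ‖z - w‖ := by
  have h : ∀ x y : ℝ, |(projIcc (-1 : ℝ) 1 (by norm_num) x : ℝ) - projIcc (-1 : ℝ) 1 (by norm_num) y|
      ≤ |x - y| := fun x y => by
    have := (LipschitzWith.projIcc (by norm_num : (-1 : ℝ) ≤ 1)).dist_le_mul x y
    simpa [Subtype.dist_eq, Real.dist_eq] using this
  exact norm_le_norm_of_abs_le (by simpa [squareProj] using h z.re w.re)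
    (by simpa [squareProj] using h z.im w.im)

theorem squareProj_zero : squareProj 0 = 0 := by
  apply Complex.ext <;> simp [squareProj, projIcc]

theorem norm_squareProj_le (z : ℂ) : ‖squareProj z‖ ≤ ‖z‖ := by
  simpa [squareProj_zero] using norm_squareProj_sub_le z 0

theorem norm_squareProj_le_three (z : ℂ) : ‖squareProj z‖ ≤ 3 := by
  have h : ∀ x : ℝ, |(projIcc (-1 : ℝ) 1 (by norm_num) x : ℝ)| ≤ 1 := fun x =>
    abs_le.2 (projIcc (-1 : ℝ) 1 (by norm_num) x).2
  refine (Complex.norm_le_abs_re_add_abs_im _).trans ?_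
  have h1 := h z.re
  have h2 := h z.im
  simp only [squareProj]
  linarith

theorem squareProj_of_norm_le {z : ℂ} (hz : ‖z‖ ≤ 1) : squareProj z = z := by
  have h1 := abs_le.1 ((Complex.abs_re_le_norm z).trans hz)
  have h2 := abs_le.1 ((Complex.abs_im_le_norm z).trans hz)
  apply Complex.ext
  · simp [squareProj, projIcc_of_mem (by norm_num : (-1 : ℝ) ≤ 1) (x := z.re) h1]
  · simp [squareProj, projIcc_of_mem (by norm_num : (-1 : ℝ) ≤ 1) (x := z.im) h2]

/-- A Lipschitz cutoff, equal to `1` on the disc of radius `2` and to `0` off the disc of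
radius `3`. -/
noncomputable def lipCutoff (z : ℂ) : ℝ := max 0 (min 1 (3 - ‖z‖))

theorem lipCutoff_nonneg (z : ℂ) : 0 ≤ lipCutoff z := le_max_left _ _

theorem lipCutoff_le_one (z : ℂ) : lipCutoff z ≤ 1 := max_le zero_le_one (min_le_left _ _)

theorem lipCutoff_of_norm_le {z : ℂ} (hz : ‖z‖ ≤ 2) : lipCutoff z = 1 := by
  rw [lipCutoff, min_eq_left (by linarith), max_eq_right zero_le_one]

theorem lipCutoff_of_lt_norm {z : ℂ} (hz : 3 < ‖z‖) : lipCutoff z = 0 := by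
  rw [lipCutoff, max_eq_left]
  exact (min_le_right _ _).trans (by linarith)

theorem holderBound_lipCutoff {α : ℝ} (hα0 : 0 < α) (hα1 : α < 1) :
    HolderBound α univ 2 lipCutoff := by
  have := holderBound_of_lipschitz (S := univ) (f := lipCutoff) (M := 1) hα0 hα1 zero_le_one
    (fun z _ => by
      rw [Real.norm_eq_abs, abs_of_nonneg (lipCutoff_nonneg z)]
      exact lipCutoff_le_one z)
    (fun z _ w _ => by
      rw [Real.norm_eq_abs, one_mul]
      refine (abs_max_sub_max_le_max _ _ _ _).trans (max_le (by simp) ?_)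
      refine (abs_min_sub_min_le_max _ _ _ _).trans (max_le (by simp) ?_)
      rw [sub_sub_sub_cancel_left, ← norm_sub_rev]
      exact abs_norm_sub_norm_le w z)
  simpa using this

variable (E : Type*) [NormedAddCommGroup E] [NormedSpace ℂ E] [NormedSpace ℝ E] [CompleteSpace E]
  [IsScalarTower ℝ ℂ E] {α : ℝ}

/-- A right inverse `g ↦ v` of `∂₁ + i ∂ᵢ` on the disc, for functions on the plane. The value
of the operator is `(v, ∂₁ v, ∂ᵢ v)` on the disc, continued to the plane through `squareProj`.
Its norm on the bounded functions with weight `exp (-b ‖squareProj z‖ ^ 2)` is at most `ε`. -/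
theorem exists_solutionOperator (hα0 : 0 < α) (hα1 : α < 1) {ε : ℝ} (hε : 0 < ε) :
    ∃ (b C : ℝ) (V : (ℂ → E) → ℂ → E × E × E), 0 < b ∧ 0 ≤ C ∧
      (∀ g M, 0 ≤ M → HolderBound α univ M g → HolderBound α univ (C * M) (V g)) ∧
      (∀ g g' M M', 0 ≤ M → 0 ≤ M' → HolderBound α univ M g → HolderBound α univ M' g' →
        ∀ z, V (fun w => g w - g' w) z = V g z - V g' z) ∧
      (∀ g N, 0 ≤ N → Continuous g → (∀ w, ‖g w‖ ≤ N) →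
        HolderBound α univ (C * N) (fun z => (V g z).1)) ∧
      (∀ g N, Continuous g → (∀ w, ‖g w‖ ≤ N * Real.exp (b * ‖squareProj w‖ ^ 2)) →
        ∀ z, ‖(V g z).1‖ ≤ ε * N * Real.exp (b * ‖squareProj z‖ ^ 2)) ∧
      (∀ g M, 0 ≤ M → HolderBound α univ M g → ∀ z, ‖z‖ < 1 →
        ∃ D : ℂ →L[ℝ] E, HasFDerivAt (fun z => (V g z).1) D z ∧ D 1 = (V g z).2.1 ∧
          D Complex.I = (V g z).2.2 ∧ (V g z).2.1 + Complex.I • (V g z).2.2 = g z) := by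
  set c := ‖(∫ t, radialMass t)⁻¹‖ with hc
  obtain ⟨b, hb, hbε⟩ : ∃ b, 0 < b ∧ c * ∫ t : ℂ, ‖t‖⁻¹ * Real.exp (-b * ‖t‖ ^ 2) ≤ ε := by
    have h1 := tendsto_integral_inv_norm_mul_exp.const_mul c
    rw [mul_zero] at h1
    obtain ⟨b, hb1, hb2⟩ := ((eventually_gt_atTop 0).and (h1.eventually (gt_mem_nhds hε))).exists
    exact ⟨b, hb1, hb2.le⟩
  obtain ⟨C1, hC1, h1⟩ := exists_holderBound_dbarInv E hα0 hα1 b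
  obtain ⟨C2, hC2, h2⟩ := exists_holderBound_dbarInvDeriv E hα0 hα1 b
  -- the argument is cut off outside the disc of radius `3`, which contains the square `[-1, 1]²`
  set T : (ℂ → E) → ℂ → E := fun g w => lipCutoff w • g w with hT
  set A := 2 * (‖(ContinuousLinearMap.lsmul ℝ ℝ : ℝ →L[ℝ] E →L[ℝ] E)‖ * 2) with hA
  have hA0 : 0 ≤ A := by positivity
  have hTb : ∀ g M, HolderBound α univ M g → HolderBound α univ (A * M) (T g) := fun g M hg =>
    ((holderBound_lipCutoff hα0 hα1).clm_comp
      (ContinuousLinearMap.lsmul ℝ ℝ : ℝ →L[ℝ] E →L[ℝ] E)).clm_apply hg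
  have hTs : ∀ g w, 3 < ‖w‖ → T g w = 0 := fun g w hw => by
    simp [hT, lipCutoff_of_lt_norm hw]
  have hTn : ∀ g w, ‖T g w‖ ≤ ‖g w‖ := fun g w => by
    rw [norm_smul, Real.norm_eq_abs, abs_of_nonneg (lipCutoff_nonneg w)]
    exact mul_le_of_le_one_left (norm_nonneg _) (lipCutoff_le_one w)
  have hTc : ∀ g, Continuous g → Continuous (T g) := fun g hg =>
    ((holderBound_lipCutoff hα0 hα1).continuous hα0).smul hg
  have hTsub : ∀ g g', T (fun w => g w - g' w) = fun w => T g w - T g' w := fun g g' => by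
    funext w
    simp [hT, smul_sub]
  have hr : MapsTo squareProj univ (Metric.closedBall 0 3) := fun z _ => by
    simpa using norm_squareProj_le_three z
  refine ⟨b, C1 + C2 * A + C1 * A, fun g z => (dbarInv b (T g) (squareProj z),
    dbarInvDeriv b 1 (T g) (squareProj z), dbarInvDeriv b Complex.I (T g) (squareProj z)),
    hb, by positivity, fun g M hM hg => ?_, fun g g' M M' hM hM' hg hg' z => ?_,
    fun g N hN hgc hgN => ?_, fun g N hgc hgN z => ?_, fun g M hM hg z hz => ?_⟩
  · have k1 := h1 (T g) (A * M) (by positivity) (hTc g (hg.continuous hα0)) (hTs g)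
      fun w => (hTb g M hg).1 w trivial
    obtain ⟨k2, k3⟩ := h2 (T g) (A * M) (by positivity) (hTb g M hg) (hTs g)
    have e1 : 0 ≤ C1 * M := by positivity
    have e2 : 0 ≤ C2 * A * M := by positivity
    have e3 : 0 ≤ C1 * A * M := by positivity
    exact ((k1.mono (by linarith)).comp_right hα0.le (by positivity) hr norm_squareProj_sub_le).prodMk
      (((k2.mono (by linarith)).comp_right hα0.le (by positivity) hr norm_squareProj_sub_le).prodMk
        ((k3.mono (by linarith)).comp_right hα0.le (by positivity) hr norm_squareProj_sub_le))
  · have hc := hg.continuous hα0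
    have hc' := hg'.continuous hα0
    have hd := fun e => dbarInvDeriv_sub hα0 hα1 b (by positivity : 0 ≤ A * M)
      (by positivity : 0 ≤ A * M') (hTb g M hg) (hTb g' M' hg') (hTs g) (hTs g') e (squareProj z)
    simp only [hTsub, dbarInv_sub b (hTc g hc) (hTc g' hc') (hTs g) (hTs g'), hd]
    rfl
  · have k1 := (h1 (T g) N hN (hTc g hgc) (hTs g) fun w => (hTn g w).trans (hgN w)).comp_right
      hα0.le (by positivity) hr norm_squareProj_sub_le
    refine k1.mono ?_
    have e1 : 0 ≤ C2 * A * N := by positivity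
    have e2 : 0 ≤ C1 * A * N := by positivity
    linarith
  · have hN : 0 ≤ N := by
      have := (norm_nonneg _).trans (hgN 0)
      exact nonneg_of_mul_nonneg_left this (Real.exp_pos _)
    refine (norm_dbarInv_le hb (hTc g hgc) (hTs g) (N := N) (fun w => ?_)
      (norm_squareProj_le_three z)).trans ?_
    · refine (hTn g w).trans ((hgN w).trans ?_)
      gcongr
      exact norm_squareProj_le w
    · gcongr
  · obtain ⟨D, hD, hDe⟩ := hasFDerivAt_dbarInv hα0 hα1 b (by positivity : 0 ≤ A * M) (hTb g M hg)
      (hTs g) z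
    have hz' : squareProj z = z := squareProj_of_norm_le hz.le
    refine ⟨D, hD.congr_of_eventuallyEq ?_, ?_, ?_, ?_⟩
    · filter_upwards [Metric.isOpen_ball.mem_nhds (show z ∈ Metric.ball (0 : ℂ) 1 by simpa using hz)]
        with w hw
      rw [squareProj_of_norm_le (by simpa using (mem_ball_zero_iff.1 hw).le)]
    · simp only [hz', hDe]
    · simp only [hz', hDe]
    · simp only [hz']
      rw [dbar_dbarInv hα0 hα1 b (by positivity : 0 ≤ A * M) (hTb g M hg) (hTs g) (by linarith)]
      simp [hT, lipCutoff_of_norm_le (by linarith : ‖z‖ ≤ 2)]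

end SolutionOperator

/-! ### Fixed points in weighted Hölder norms -/

section FixedPoint

variable {E : Type*} [NormedAddCommGroup E] {α L M M' : ℝ} {ω : ℂ → ℝ} {f g : ℂ → E}

/-- A bound by `M` in the norm of `C^{0,α}` in which the supremum norm carries the weight `1 / ω`
and the Hölder seminorm the factor `1 / L`. -/
def WeightedBound (α : ℝ) (ω : ℂ → ℝ) (L M : ℝ) (f : ℂ → E) : Prop :=
  (∀ z, ‖f z‖ ≤ M * ω z) ∧ ∀ z w, ‖f z - f w‖ ≤ M * L * ‖z - w‖ ^ α

theorem WeightedBound.add (hf : WeightedBound α ω L M f) (hg : WeightedBound α ω L M' g) :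
    WeightedBound α ω L (M + M') (fun z => f z + g z) := by
  refine ⟨fun z => (norm_add_le _ _).trans ?_, fun z w => ?_⟩
  · rw [add_mul]
    exact add_le_add (hf.1 z) (hg.1 z)
  · rw [add_sub_add_comm, add_mul, add_mul]
    exact (norm_add_le _ _).trans (add_le_add (hf.2 z w) (hg.2 z w))

theorem WeightedBound.mono (hf : WeightedBound α ω L M f) (hω : ∀ z, 0 ≤ ω z) (hL : 0 ≤ L)
    (hM : M ≤ M') : WeightedBound α ω L M' f :=
  ⟨fun z => (hf.1 z).trans (mul_le_mul_of_nonneg_right hM (hω z)),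
    fun z w => (hf.2 z w).trans (by gcongr)⟩

/-- Picard iteration in the weighted Hölder norm. -/
theorem exists_fixedPoint_of_weightedBound [CompleteSpace E] (hω : ∀ z, 0 ≤ ω z) (hL : 0 ≤ L)
    {η : ℝ} (hη : 0 ≤ η) (Θ : (ℂ → E) → ℂ → E) (h0 : WeightedBound α ω L η (Θ fun _ => 0))
    (hΘ : ∀ g g' M, 0 ≤ M → WeightedBound α ω L (2 * η) g → WeightedBound α ω L (2 * η) g' →
      WeightedBound α ω L M (fun z => g z - g' z) →
      WeightedBound α ω L (M / 2) (fun z => Θ g z - Θ g' z)) :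
    ∃ g, WeightedBound α ω L (2 * η) g ∧ ∀ z, Θ g z = g z := by
  set G : ℕ → ℂ → E := fun k => Θ^[k] (fun _ => 0) with hG
  have hGs : ∀ k, G (k + 1) = Θ (G k) := fun k => Function.iterate_succ_apply' Θ k _
  have hG0 : G 0 = fun _ => 0 := rfl
  have hpow : ∀ k : ℕ, 0 ≤ (1 / 2 : ℝ) ^ k := fun k => by positivity
  -- the increments add up to `(2 - 2 / 2 ^ k) η`, so the iterates stay in the ball of radius `2 η`
  have hind : ∀ k : ℕ, WeightedBound α ω L ((2 - 2 * (1 / 2) ^ k) * η) (G k) ∧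
      WeightedBound α ω L (η * (1 / 2) ^ k) (fun z => G (k + 1) z - G k z) := by
    intro k
    induction k with
    | zero =>
      refine ⟨?_, ?_⟩
      · rw [hG0]
        exact ⟨fun z => by simp, fun z w => by simp⟩
      · rw [hGs, hG0]
        simpa using h0
    | succ k ih =>
      obtain ⟨i1, i2⟩ := ih
      have hk1 : WeightedBound α ω L ((2 - 2 * (1 / 2) ^ (k + 1)) * η) (G (k + 1)) := by
        have := i1.add i2
        simp only [add_sub_cancel] at this
        refine this.mono hω hL (le_of_eq ?_)
        rw [pow_succ]
        ring
      refine ⟨hk1, ?_⟩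
      have j1 : WeightedBound α ω L (2 * η) (G k) :=
        i1.mono hω hL (by nlinarith [hpow k])
      have j2 : WeightedBound α ω L (2 * η) (G (k + 1)) :=
        hk1.mono hω hL (by nlinarith [hpow (k + 1)])
      have := hΘ (G (k + 1)) (G k) (η * (1 / 2) ^ k) (by positivity) j2 j1 i2
      rw [hGs (k + 1)]
      conv => arg 5; ext z; rw [hGs k]
      refine (hGs k ▸ this).mono hω hL (le_of_eq ?_)
      rw [pow_succ]
      ring
  have hd1 : ∀ z k, dist (G k z) (G (k + 1) z) ≤ η * ω z * (1 / 2) ^ k := fun z k => by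
    rw [dist_comm, dist_eq_norm]
    exact ((hind k).2.1 z).trans (le_of_eq (by ring))
  have hd2 : ∀ z w k, dist (G k z - G k w) (G (k + 1) z - G (k + 1) w)
      ≤ η * L * ‖z - w‖ ^ α * (1 / 2) ^ k := fun z w k => by
    rw [dist_comm, dist_eq_norm, sub_sub_sub_comm]
    exact ((hind k).2.2 z w).trans (le_of_eq (by ring))
  choose g hg using fun z => cauchySeq_tendsto_of_complete
    (cauchySeq_of_le_geometric (1 / 2) (η * ω z) (by norm_num) (hd1 z))
  have hdiff : ∀ k : ℕ, WeightedBound α ω L (2 * η * (1 / 2) ^ k) (fun z => g z - G k z) := by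
    intro k
    refine ⟨fun z => ?_, fun z w => ?_⟩
    · have := dist_le_of_le_geometric_of_tendsto (1 / 2) (η * ω z) (by norm_num) (hd1 z) (hg z) k
      rw [dist_comm, dist_eq_norm] at this
      refine this.trans (le_of_eq (by ring))
    · have := dist_le_of_le_geometric_of_tendsto (1 / 2) (η * L * ‖z - w‖ ^ α) (by norm_num)
        (hd2 z w) ((hg z).sub (hg w)) k
      rw [dist_comm, dist_eq_norm, sub_sub_sub_comm] at this
      refine this.trans (le_of_eq (by ring))
  have hgb : WeightedBound α ω L (2 * η) g := by
    have := hdiff 0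
    simpa [hG0] using this
  refine ⟨g, hgb, fun z => ?_⟩
  have hlim : Tendsto (fun k => G (k + 1) z) atTop (𝓝 (Θ g z)) := by
    rw [tendsto_iff_norm_sub_tendsto_zero]
    have hz : Tendsto (fun k : ℕ => η * ω z * (1 / 2 : ℝ) ^ k) atTop (𝓝 0) := by
      have := (tendsto_pow_atTop_nhds_zero_of_lt_one (r := (1 / 2 : ℝ)) (by norm_num)
        (by norm_num)).const_mul (η * ω z)
      simpa using this
    refine squeeze_zero (fun _ => norm_nonneg _) (fun k => ?_) hz
    have j1 : WeightedBound α ω L (2 * η) (G k) :=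
      (hind k).1.mono hω hL (by nlinarith [hpow k])
    have := (hΘ g (G k) (2 * η * (1 / 2) ^ k) (by positivity) hgb j1 (hdiff k)).1 z
    rw [norm_sub_rev, hGs]
    exact this.trans (le_of_eq (by ring))
  exact tendsto_nhds_unique hlim ((tendsto_add_atTop_iff_nat 1).2 (hg z))

end FixedPoint

/-! ### The nonlinear Cauchy-Riemann equation -/

section NonlinearEquation

variable {E Y : Type*} [NormedAddCommGroup E] [NormedSpace ℂ E] [NormedSpace ℝ E] [CompleteSpace E]
  [IsScalarTower ℝ ℂ E] [FiniteDimensional ℝ E] [NormedAddCommGroup Y] [NormedSpace ℝ Y]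
  [FiniteDimensional ℝ Y] {α : ℝ}

/-- Solvability on the unit disc, for small `f` and with estimates, of the equation
`Ψ (y, v, ∂₁ v, ∂ᵢ v) = Ψ (y, 0) - f`, if the restriction of `Ψ` to `v = 0` is affine with
principal part `i (∂₁ + i ∂ᵢ)`. The solution is given as `V = (v, ∂₁ v, ∂ᵢ v)`. -/
theorem exists_solution_nonlinear (hα0 : 0 < α) (hα1 : α < 1) {Ψ : Y × (E × E × E) → E}
    (hΨ : ContDiff ℝ 3 Ψ)
    (hlin : ∀ a p q, Ψ (a, 0, p, q) = Ψ (a, 0) + Complex.I • (p + Complex.I • q))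
    {y : ℂ → Y} {R : ℝ} (hy : HolderBound α univ R y) :
    ∃ δ C, 0 < δ ∧ 0 ≤ C ∧ ∀ (f : ℂ → E) (η : ℝ), 0 ≤ η → η ≤ δ → HolderBound α univ η f →
      ∃ V : ℂ → E × E × E, HolderBound α univ (C * η) V ∧ ∀ z, ‖z‖ < 1 →
        (∃ D : ℂ →L[ℝ] E, HasFDerivAt (fun z => (V z).1) D z ∧ D 1 = (V z).2.1 ∧
          D Complex.I = (V z).2.2) ∧ Ψ (y z, V z) = Ψ (y z, 0) - f z := by
  have hR : 0 ≤ R := (norm_nonneg _).trans (hy.1 0 trivial)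
  -- the coefficient of the terms of order zero of the linearization
  set J₁ : E →L[ℝ] Y × (E × E × E) := (ContinuousLinearMap.inr ℝ Y (E × E × E)).comp
    (ContinuousLinearMap.inl ℝ E (E × E)) with hJ₁
  obtain ⟨B, hB0, hB⟩ : ∃ B, 0 ≤ B ∧
      HolderBound α univ B (fun z => (fderiv ℝ Ψ (y z, 0)).comp J₁) := by
    have hs : ContDiff ℝ 1 fun a : Y => (fderiv ℝ Ψ (a, 0)).comp J₁ :=
      ((hΨ.fderiv_right (m := 1) (by norm_num)).comp (contDiff_id.prodMk contDiff_const)).clm_comp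
        contDiff_const
    obtain ⟨B, hB0, hB⟩ := HolderBound.exists_contDiff_comp hs α R
    exact ⟨B, hB0, hB univ y hy⟩
  have hlinD : ∀ a p q, fderiv ℝ Ψ (a, 0) (0, 0, p, q) = Complex.I • (p + Complex.I • q) := by
    intro a p q
    have h1 : HasDerivAt (fun t : ℝ => ((a, 0) : Y × (E × E × E)) + t • (0, 0, p, q))
        (0, 0, p, q) 0 := by
      simpa using ((hasDerivAt_id (0 : ℝ)).smul_const ((0, 0, p, q) : Y × (E × E × E))).const_add
        ((a, 0) : Y × (E × E × E))
    have h0 : HasFDerivAt Ψ (fderiv ℝ Ψ (a, 0))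
        (((a, 0) : Y × (E × E × E)) + (0 : ℝ) • (0, 0, p, q)) := by
      simpa using (hΨ.differentiable three_ne_zero (a, 0)).hasFDerivAt
    have h2 := h0.comp_hasDerivAt (0 : ℝ) h1
    have h3 : HasDerivAt (fun t : ℝ => Ψ (a, 0) + t • (Complex.I • (p + Complex.I • q)))
        (Complex.I • (p + Complex.I • q)) 0 := by
      simpa using ((hasDerivAt_id (0 : ℝ)).smul_const (Complex.I • (p + Complex.I • q))).const_add
        (Ψ (a, 0))
    refine h2.unique (h3.congr_of_eventuallyEq (Eventually.of_forall fun t => ?_))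
    simp only [Function.comp, Prod.smul_mk, smul_zero, Prod.mk_add_mk, add_zero]
    have : ((0 : E × E × E) + (0, t • p, t • q)) = (0, t • p, t • q) := by simp
    rw [this, hlin, smul_comm t Complex.I, smul_add t, smul_comm t Complex.I q]
  obtain ⟨b, C, V, hb, hC, hV, hVsub, hVsup, hVw, hVd⟩ :=
    exists_solutionOperator E hα0 hα1 (ε := 1 / (4 * (B + 1))) (by positivity)
  obtain ⟨CR, hCR, hrem⟩ := HolderBound.exists_remainder hΨ α (max R 1)
  set ω : ℂ → ℝ := fun z => Real.exp (b * ‖squareProj z‖ ^ 2) with hω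
  have hω0 : ∀ z, 0 ≤ ω z := fun z => (Real.exp_pos _).le
  have hω1 : ∀ z, 1 ≤ ω z := fun z => Real.one_le_exp (by positivity)
  set W := Real.exp (b * 9) with hW
  have hW1 : 1 ≤ W := Real.one_le_exp (by positivity)
  have hωW : ∀ z, ω z ≤ W := fun z => by
    refine Real.exp_le_exp.2 ?_
    have h1 := norm_squareProj_le_three z
    have h2 := norm_nonneg (squareProj z)
    gcongr
    nlinarith
  -- the weight of the Hölder seminorm is chosen after `b`, which fixes the constant `C`
  set L := W + 8 * B * C * W with hL
  have hLW : W ≤ L := by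
    have : 0 ≤ 8 * B * C * W := by positivity
    linarith
  have hL1 : 1 ≤ L := hW1.trans hLW
  have hL0 : 0 ≤ L := zero_le_one.trans hL1
  have hWH : ∀ (g : ℂ → E) (M : ℝ), 0 ≤ M → WeightedBound α ω L M g →
      HolderBound α univ (M * L) g := fun g M hM hg =>
    ⟨fun z _ => (hg.1 z).trans (mul_le_mul_of_nonneg_left ((hωW z).trans hLW) hM),
      fun z _ w _ => hg.2 z w⟩
  -- the equation for `V = V g`, solved for the principal part `i g`
  set Θ : (ℂ → E) → (ℂ → E) → ℂ → E := fun f g z => Complex.I • (f z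
    + fderiv ℝ Ψ (y z, 0) (0, (V g z).1, 0, 0)
    + (Ψ (y z, V g z) - Ψ (y z, 0) - fderiv ℝ Ψ (y z, 0) (0, V g z))) with hΘ
  -- for data of size `1 / (2 L (K + C + 1))` the terms of order two contribute a factor `1 / 4`
  set K := 4 * (CR * C * C * L + 1) with hK
  have hK0 : 0 < K := by positivity
  refine ⟨1 / (2 * L * (K + C + 1)), C * (2 * L), by positivity, by positivity,
    fun f η hη hηδ hf => ?_⟩
  have hsmall : 2 * η * L * (K + C + 1) ≤ 1 := by
    rw [le_div_iff₀ (by positivity)] at hηδ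
    linarith
  set δ := C * (2 * η * L) with hδ
  have hδ1 : δ ≤ max R 1 := by
    refine le_trans ?_ (le_max_right _ _)
    have : 0 ≤ 2 * η * L * (K + 1) := by positivity
    rw [hδ]
    linarith
  have hV0 : ∀ z, V (fun _ => 0) z = 0 := by
    intro z
    have h0 := HolderBound.zero (E := E) α univ le_rfl
    have := hVsub (fun _ => 0) (fun _ => 0) 0 0 le_rfl le_rfl h0 h0 z
    simpa using this
  have hstart : WeightedBound α ω L η (Θ f fun _ => 0) := by
    have e : Θ f (fun _ => 0) = fun z => Complex.I • f z := by
      funext z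
      have z1 : fderiv ℝ Ψ (y z, 0) (0, (0 : E), (0 : E), (0 : E)) = 0 := map_zero _
      have z2 : fderiv ℝ Ψ (y z, 0) (0, (0 : E × E × E)) = 0 := map_zero _
      simp only [hΘ, hV0, Prod.fst_zero, z1, z2, sub_self, add_zero]
    rw [e]
    refine ⟨fun z => ?_, fun z w => ?_⟩
    · rw [norm_smul, Complex.norm_I, one_mul]
      exact (hf.1 z trivial).trans (le_mul_of_one_le_right hη (hω1 z))
    · rw [← smul_sub, norm_smul, Complex.norm_I, one_mul]
      refine (hf.2 z trivial w trivial).trans ?_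
      gcongr
      exact le_mul_of_one_le_right hη hL1
  have hcontr : ∀ g g' M, 0 ≤ M → WeightedBound α ω L (2 * η) g → WeightedBound α ω L (2 * η) g' →
      WeightedBound α ω L M (fun z => g z - g' z) →
      WeightedBound α ω L (M / 2) (fun z => Θ f g z - Θ f g' z) := by
    intro g g' M hM hg hg' hd
    have hgH := hWH g _ (by positivity) hg
    have hgH' := hWH g' _ (by positivity) hg'
    have hdH := hWH _ M hM hd
    have hdc := hdH.continuous hα0
    have hsub := hVsub g g' _ _ (by positivity) (by positivity) hgH hgH'
    -- the terms of order zero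
    have hsup : ∀ w, ‖g w - g' w‖ ≤ M * W := fun w =>
      (hd.1 w).trans (mul_le_mul_of_nonneg_left (hωW w) hM)
    have hv := hVsup (fun w => g w - g' w) (M * W) (by positivity) hdc hsup
    have h1 := hB.clm_apply hv
    have h1w : ∀ z, ‖(fderiv ℝ Ψ (y z, 0)).comp J₁ (V (fun w => g w - g' w) z).1‖
        ≤ M / 4 * ω z := by
      intro z
      have h2 := hVw (fun w => g w - g' w) M hdc hd.1 z
      refine (((fderiv ℝ Ψ (y z, 0)).comp J₁).le_of_opNorm_le_of_le (hB.1 z trivial) h2).trans ?_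
      have h3 : B * (1 / (4 * (B + 1))) ≤ 1 / 4 := by
        rw [mul_one_div, div_le_div_iff₀ (by positivity) (by norm_num)]
        linarith
      calc B * (1 / (4 * (B + 1)) * M * ω z) = B * (1 / (4 * (B + 1))) * (M * ω z) := by ring
        _ ≤ 1 / 4 * (M * ω z) := by
            have := mul_nonneg hM (hω0 z)
            gcongr
        _ = _ := by ring
    -- the terms of order two
    have hVd := hV _ (M * L) (by positivity) hdH
    have h4 := hrem univ y (V g) (V g') δ (C * (M * L)) hδ1 (hy.mono (le_max_left _ _))
      (hV g _ (by positivity) hgH) (hV g' _ (by positivity) hgH')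
      (hVd.congr fun z _ => (hsub z).symm)
    have h4' := h4.mono (M' := M / 4) (by
      have h5 : CR * δ * C * L ≤ 1 / 4 := by
        have h6 : 0 ≤ 2 * η * L * (C + 1) := by positivity
        have h7 : 2 * η * L * K ≤ 1 := by linarith
        have h8 : CR * δ * C * L = 2 * η * L * (CR * C * C * L) := by rw [hδ]; ring
        have h9 : 0 ≤ 2 * η * L := by positivity
        rw [h8]
        nlinarith
      calc CR * δ * (C * (M * L)) = CR * δ * C * L * M := by ring
        _ ≤ 1 / 4 * M := by gcongr
        _ = _ := by ring)
    have e : ∀ z, Θ f g z - Θ f g' z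
        = Complex.I • ((fderiv ℝ Ψ (y z, 0)).comp J₁ (V (fun w => g w - g' w) z).1
          + (Ψ (y z, V g z) - Ψ (y z, V g' z) - fderiv ℝ Ψ (y z, 0) (0, V g z - V g' z))) := by
      intro z
      have e1 : (fderiv ℝ Ψ (y z, 0)).comp J₁ (V (fun w => g w - g' w) z).1
          = fderiv ℝ Ψ (y z, 0) (0, (V g z).1, 0, 0) - fderiv ℝ Ψ (y z, 0) (0, (V g' z).1, 0, 0) := by
        rw [← map_sub, hsub]
        simp [hJ₁]
      have e2 : fderiv ℝ Ψ (y z, 0) (0, V g z - V g' z)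
          = fderiv ℝ Ψ (y z, 0) (0, V g z) - fderiv ℝ Ψ (y z, 0) (0, V g' z) := by
        rw [← map_sub]
        simp
      simp only [hΘ]
      rw [← smul_sub, e1, e2]
      congr 1
      abel
    simp only [e]
    refine ⟨fun z => ?_, fun z w => ?_⟩
    · rw [norm_smul, Complex.norm_I, one_mul]
      calc _ ≤ M / 4 * ω z + M / 4 := (norm_add_le _ _).trans (add_le_add (h1w z) (h4'.1 z trivial))
        _ ≤ M / 4 * ω z + M / 4 * ω z := by
            gcongr
            exact le_mul_of_one_le_right (by positivity) (hω1 z)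
        _ = _ := by ring
    · rw [← smul_sub, norm_smul, Complex.norm_I, one_mul, add_sub_add_comm]
      have h5 : 2 * B * (C * (M * W)) ≤ M / 4 * L := by
        rw [hL]
        have : 0 ≤ M / 4 * W := by positivity
        linarith
      have h6 : (0 : ℝ) ≤ ‖z - w‖ ^ α := by positivity
      calc _ ≤ 2 * B * (C * (M * W)) * ‖z - w‖ ^ α + M / 4 * ‖z - w‖ ^ α :=
            (norm_add_le _ _).trans (add_le_add (h1.2 z trivial w trivial)
              (h4'.2 z trivial w trivial))
        _ ≤ M / 4 * L * ‖z - w‖ ^ α + M / 4 * L * ‖z - w‖ ^ α := by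
            gcongr
            exact le_mul_of_one_le_right (by positivity) hL1
        _ = _ := by ring
  obtain ⟨g, hg, hfix⟩ := exists_fixedPoint_of_weightedBound hω0 hL0 hη (Θ f) hstart hcontr
  have hgH := hWH g _ (by positivity) hg
  refine ⟨V g, (hV g _ (by positivity) hgH).mono (le_of_eq (by ring)), fun z hz => ?_⟩
  obtain ⟨D, hD, hD1, hDI, hDg⟩ := hVd g _ (by positivity) hgH z hz
  refine ⟨⟨D, hD, hD1, hDI⟩, ?_⟩
  have h1 : fderiv ℝ Ψ (y z, 0) (0, V g z)
      = fderiv ℝ Ψ (y z, 0) (0, (V g z).1, 0, 0) + Complex.I • g z := by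
    have e : ((0, V g z) : Y × (E × E × E))
        = (0, (V g z).1, 0, 0) + (0, 0, (V g z).2.1, (V g z).2.2) :=
      Prod.ext (by simp) (Prod.ext (by simp) (Prod.ext (by simp) (by simp)))
    rw [← hDg, ← hlinD (y z), ← map_add, ← e]
  have h2 := hfix z
  simp only [hΘ] at h2
  have h3 : Complex.I • g z = -(f z + fderiv ℝ Ψ (y z, 0) (0, (V g z).1, 0, 0)
      + (Ψ (y z, V g z) - Ψ (y z, 0) - fderiv ℝ Ψ (y z, 0) (0, V g z))) := by
    conv_lhs => rw [← h2]
    rw [smul_smul, Complex.I_mul_I, neg_one_smul]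
  rw [h1] at h3
  have h4 : Ψ (y z, V g z) - (Ψ (y z, 0) - f z) = 0 := by
    have := sub_eq_zero.2 h3
    rw [← this]
    abel
  exact sub_eq_zero.1 h4

end NonlinearEquation

/-! ### Comparison with the norms of `C^{0,α}` -/

section Norms

variable {E : Type*} [NormedAddCommGroup E] {α : ℝ≥0} {Ω : Set ℂ} {f : ℂ → E}

theorem holderBound_toReal_normC0 (h : normC0 α Ω f ≠ ⊤) :
    HolderBound α Ω (normC0 α Ω f).toReal f := by
  have h2 : eHolderNorm α (Ω.domRestrict f) ≠ ⊤ := fun hh => h (by rw [normC0, hh, add_top])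
  have hm : MemHolder α (Ω.domRestrict f) := eHolderNorm_ne_top.1 h2
  refine ⟨fun z hz => ?_, fun z hz w hw => ?_⟩
  · rw [← toReal_enorm]
    refine ENNReal.toReal_mono h (le_trans ?_ le_self_add)
    exact le_iSup₂ (f := fun ζ (_ : ζ ∈ Ω) => ‖f ζ‖ₑ) z hz
  · have h3 := hm.holderWith.dist_le ⟨z, hz⟩ ⟨w, hw⟩
    rw [dist_eq_norm, Subtype.dist_eq, dist_eq_norm] at h3
    refine h3.trans ?_
    gcongr
    have h4 : (nnHolderNorm α (Ω.domRestrict f) : ℝ≥0∞) ≤ normC0 α Ω f :=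
      coe_nnHolderNorm_le_eHolderNorm.trans le_add_self
    simpa using ENNReal.toReal_mono h h4

theorem normC0_le_of_holderBound {M : ℝ} (hM : 0 ≤ M) (h : HolderBound α Ω M f) :
    normC0 α Ω f ≤ ENNReal.ofReal (2 * M) := by
  rw [two_mul, ENNReal.ofReal_add hM hM]
  refine add_le_add (iSup₂_le fun z hz => ?_) ?_
  · rw [← ofReal_norm]
    exact ENNReal.ofReal_le_ofReal (h.1 z hz)
  · refine HolderWith.eHolderNorm_le (C := M.toNNReal) fun z w => ?_
    rw [edist_dist, edist_dist, ENNReal.ofReal_rpow_of_nonneg dist_nonneg α.coe_nonneg,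
      show ((M.toNNReal : ℝ≥0) : ℝ≥0∞) = ENNReal.ofReal M from rfl, ← ENNReal.ofReal_mul hM]
    refine ENNReal.ofReal_le_ofReal ?_
    rw [dist_eq_norm, Subtype.dist_eq, dist_eq_norm]
    exact h.2 _ z.2 _ w.2

end Norms

/-! ### Reduction of the equation for holomorphic curves -/

section Structure

variable {n : ℕ} {J : Cn n → Cn n →L[ℝ] Cn n}

/-- The operator `J_st + J(a)`, which conjugates `J(a)` to `J_st`; it is invertible if `J` is
admissible. -/
noncomputable def conjugator (J : Cn n → Cn n →L[ℝ] Cn n) (a : Cn n) : Cn n →L[ℝ] Cn n :=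
  Jst n + J a

theorem Jst_apply (x : Cn n) : Jst n x = Complex.I • x := rfl

theorem Jst_Jst (x : Cn n) : Jst n (Jst n x) = -x := by
  rw [Jst_apply, Jst_apply, smul_smul, Complex.I_mul_I, neg_one_smul]

theorem IsAdmissible.apply_apply (hJ : IsAdmissible J) (a x : Cn n) : J a (J a x) = -x := by
  simpa using congrArg (fun T : Cn n →L[ℝ] Cn n => T x) (hJ.sq_eq a)

theorem IsAdmissible.conjugator_comm (hJ : IsAdmissible J) (a x : Cn n) :
    J a (conjugator J a x) = conjugator J a (Complex.I • x) := by
  rw [← Jst_apply]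
  simp only [conjugator, add_apply, map_add, hJ.apply_apply, Jst_Jst]
  abel

theorem IsAdmissible.exists_equiv (hJ : IsAdmissible J) (a : Cn n) :
    ∃ e : Cn n ≃L[ℝ] Cn n, (e : Cn n →L[ℝ] Cn n) = conjugator J a := by
  have hdet : (conjugator J a).det ≠ 0 := by
    rw [conjugator, add_comm]
    exact hJ.det_ne a
  exact ⟨(conjugator J a).toContinuousLinearEquivOfDetNeZero hdet,
    (conjugator J a).coe_toContinuousLinearEquivOfDetNeZero hdet⟩

theorem IsAdmissible.inverse_conjugator_apply (hJ : IsAdmissible J) (a x : Cn n) :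
    (conjugator J a).inverse (conjugator J a x) = x := by
  obtain ⟨e, he⟩ := hJ.exists_equiv a
  rw [← he, ContinuousLinearMap.inverse_equiv]
  simp

theorem IsAdmissible.conjugator_inverse_apply (hJ : IsAdmissible J) (a x : Cn n) :
    conjugator J a ((conjugator J a).inverse x) = x := by
  obtain ⟨e, he⟩ := hJ.exists_equiv a
  rw [← he, ContinuousLinearMap.inverse_equiv]
  simp

theorem IsAdmissible.contDiff_conjugator (hJ : IsAdmissible J) :
    ContDiff ℝ 3 (conjugator J) :=
  contDiff_const.add (hJ.smooth.of_le (WithTop.coe_le_coe.2 (le_top (a := (3 : ℕ∞)))))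

theorem IsAdmissible.contDiff_inverse_conjugator (hJ : IsAdmissible J) :
    ContDiff ℝ 3 fun a => (conjugator J a).inverse := by
  refine contDiff_iff_contDiffAt.2 fun a => ?_
  obtain ⟨e, he⟩ := hJ.exists_equiv a
  have h := contDiffAt_map_inverse (𝕜 := ℝ) (n := 3) e
  rw [he] at h
  exact h.comp a hJ.contDiff_conjugator.contDiffAt

/-- The operator `u ↦ (J_st + J(φ))⁻¹ (J(u) ∂₁ u - ∂ᵢ u)` for `u = φ + (J_st + J(φ)) v`, as a
function of the values of `(φ, ∂₁ φ, ∂ᵢ φ)` and of `(v, ∂₁ v, ∂ᵢ v)`. -/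
noncomputable def jetOperator (J : Cn n → Cn n →L[ℝ] Cn n)
    (x : (Cn n × Cn n × Cn n) × (Cn n × Cn n × Cn n)) : Cn n :=
  (conjugator J x.1.1).inverse
    (J (x.1.1 + conjugator J x.1.1 x.2.1)
        (x.1.2.1 + fderiv ℝ J x.1.1 x.1.2.1 x.2.1 + conjugator J x.1.1 x.2.2.1)
      - (x.1.2.2 + fderiv ℝ J x.1.1 x.1.2.2 x.2.1 + conjugator J x.1.1 x.2.2.2))

theorem IsAdmissible.contDiff_jetOperator (hJ : IsAdmissible J) : ContDiff ℝ 3 (jetOperator J) := by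
  have h3 : ContDiff ℝ 3 J := hJ.smooth.of_le (WithTop.coe_le_coe.2 (le_top (a := (3 : ℕ∞))))
  have hd : ContDiff ℝ 3 (fderiv ℝ J) := hJ.smooth.fderiv_right (WithTop.coe_le_coe.2 (le_top (a := (3 : ℕ∞) + 1)))
  have ha : ContDiff ℝ 3 fun x : (Cn n × Cn n × Cn n) × (Cn n × Cn n × Cn n) => x.1.1 :=
    contDiff_fst.comp contDiff_fst
  have hp : ContDiff ℝ 3 fun x : (Cn n × Cn n × Cn n) × (Cn n × Cn n × Cn n) => x.1.2.1 :=
    (contDiff_fst.comp contDiff_snd).comp contDiff_fst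
  have hq : ContDiff ℝ 3 fun x : (Cn n × Cn n × Cn n) × (Cn n × Cn n × Cn n) => x.1.2.2 :=
    (contDiff_snd.comp contDiff_snd).comp contDiff_fst
  have hv : ContDiff ℝ 3 fun x : (Cn n × Cn n × Cn n) × (Cn n × Cn n × Cn n) => x.2.1 :=
    contDiff_fst.comp contDiff_snd
  have hv1 : ContDiff ℝ 3 fun x : (Cn n × Cn n × Cn n) × (Cn n × Cn n × Cn n) => x.2.2.1 :=
    (contDiff_fst.comp contDiff_snd).comp contDiff_snd
  have hv2 : ContDiff ℝ 3 fun x : (Cn n × Cn n × Cn n) × (Cn n × Cn n × Cn n) => x.2.2.2 :=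
    (contDiff_snd.comp contDiff_snd).comp contDiff_snd
  have hP := hJ.contDiff_conjugator.comp ha
  have hD := hd.comp ha
  exact (hJ.contDiff_inverse_conjugator.comp ha).clm_apply
    (((h3.comp (ha.add (hP.clm_apply hv))).clm_apply
        ((hp.add ((hD.clm_apply hp).clm_apply hv)).add (hP.clm_apply hv1))).sub
      ((hq.add ((hD.clm_apply hq).clm_apply hv)).add (hP.clm_apply hv2)))

/-- The conjugation by `J_st + J` turns the principal part of the operator into
`i (∂₁ + i ∂ᵢ)`. -/
theorem IsAdmissible.jetOperator_zero (hJ : IsAdmissible J) (a : Cn n × Cn n × Cn n) (p q : Cn n) :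
    jetOperator J (a, 0, p, q) = jetOperator J (a, 0) + Complex.I • (p + Complex.I • q) := by
  have h : ∀ x y : Cn n, J a.1 (x + conjugator J a.1 p) - (y + conjugator J a.1 q)
      = (J a.1 x - y) + conjugator J a.1 (Complex.I • (p + Complex.I • q)) := by
    intro x y
    rw [smul_add, smul_smul, Complex.I_mul_I, neg_one_smul, map_add, map_add, hJ.conjugator_comm,
      map_neg]
    abel
  simp only [jetOperator, Prod.fst_zero, Prod.snd_zero, map_zero, add_zero]
  rw [h, map_add, hJ.inverse_conjugator_apply]

theorem conjCn_conjCn (v : Cn n) : conjCn (conjCn v) = v := by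
  ext i
  simp [conjCn]

/-- At `v = 0`, that is, at `u = φ`, the deformed operator is `opF J φ`. -/
theorem IsAdmissible.opF_eq (hJ : IsAdmissible J) (φ : ℂ → Cn n) (ζ : ℂ) :
    opF J φ ζ = jetOperator J ((φ ζ, fderiv ℝ φ ζ 1, fderiv ℝ φ ζ Complex.I), 0) := by
  set p := fderiv ℝ φ ζ 1 with hp
  set q := fderiv ℝ φ ζ Complex.I with hq
  have h1 : jetOperator J ((φ ζ, p, q), 0) = (conjugator J (φ ζ)).inverse (J (φ ζ) p - q) := by
    simp [jetOperator]
  have h2 : dZetaBar φ ζ = (conjugator J (φ ζ)).inverse (conjugator J (φ ζ) (dZetaBar φ ζ)) :=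
    (hJ.inverse_conjugator_apply _ _).symm
  rw [h1, opF, h2, complexMatrix, conjCn_conjCn]
  change _ + (conjugator J (φ ζ)).inverse _ = _
  rw [← map_add]
  congr 1
  have e1 : dZetaBar φ ζ = (2⁻¹ : ℝ) • (p + Jst n q) := by
    rw [dZetaBar, Jst_apply, ← Complex.coe_smul (2⁻¹ : ℝ)]
    norm_num [hp, hq]
  have e2 : dZeta φ ζ = (2⁻¹ : ℝ) • (p - Jst n q) := by
    rw [dZeta, Jst_apply, ← Complex.coe_smul (2⁻¹ : ℝ)]
    norm_num [hp, hq]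
  rw [e1, e2, map_smul, map_smul]
  simp only [conjugator, add_apply, sub_apply, map_add, map_sub, Jst_Jst]
  module

end Structure

/-! ### Deformation to a holomorphic curve -/

section Deformation

variable {n : ℕ} {J : Cn n → Cn n →L[ℝ] Cn n} {α : ℝ≥0}

theorem memC1_of_holderBound {E : Type*} [NormedAddCommGroup E] [NormedSpace ℝ E] {Ω : Set ℂ}
    {f : ℂ → E} {M : ℝ} (hM : 0 ≤ M) (hd : DifferentiableOn ℝ f Ω) (h0 : HolderBound α Ω M f)
    (h1 : HolderBound α Ω M (fderiv ℝ f)) : MemC1 α Ω f :=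
  ⟨hd, ENNReal.add_lt_top.2 ⟨(normC0_le_of_holderBound hM h0).trans_lt ENNReal.ofReal_lt_top,
    (normC0_le_of_holderBound hM h1).trans_lt ENNReal.ofReal_lt_top⟩⟩

/-- A map of the disc for which `opF J φ` is small on an open set `Ω` is close there to a
`J`-holomorphic map, with constants that do not depend on `Ω`. -/
theorem exists_isJHolomorphicOn_near (hα0 : 0 < α) (hα1 : α < 1) (hJ : IsAdmissible J)
    {φ : ℂ → Cn n} (hφ : MemC1 α (Metric.ball (0 : ℂ) 1) φ) :
    ∃ δ C : ℝ, 0 < δ ∧ 0 ≤ C ∧ ∀ (Ω : Set ℂ) (η : ℝ), Ω ⊆ Metric.ball (0 : ℂ) 1 →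
      0 ≤ η → η ≤ δ → HolderBound α Ω η (opF J φ) →
      ∃ u : ℂ → Cn n, IsJHolomorphicOn J u Ω ∧ MemC1 α Ω u ∧
        HolderBound α Ω (C * η) (fun z => u z - φ z) ∧
        HolderBound α Ω (C * η) (fderiv ℝ fun z => u z - φ z) := by
  have hα0' : (0 : ℝ) < α := hα0
  have hα1' : (α : ℝ) < 1 := hα1
  set S := Metric.ball (0 : ℂ) 1 with hS
  obtain ⟨hφd, hφn⟩ := hφ
  obtain ⟨hn0, hn1⟩ := ENNReal.add_lt_top.1 hφn
  -- the 1-jet of `φ` and its Hölder extension to the plane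
  obtain ⟨R, hR, hφ0, hφ1, hφe⟩ : ∃ R : ℝ, 0 ≤ R ∧ HolderBound α S R φ ∧
      HolderBound α S R (fderiv ℝ φ) ∧ ∀ e : ℂ, ‖e‖ ≤ 1 → HolderBound α S R (fun z => fderiv ℝ φ z e) := by
    have h0 := holderBound_toReal_normC0 hn0.ne
    have h1 := holderBound_toReal_normC0 hn1.ne
    have t0 : 0 ≤ (normC0 α S φ).toReal := ENNReal.toReal_nonneg
    have t1 : 0 ≤ (normC0 α S (fderiv ℝ φ)).toReal := ENNReal.toReal_nonneg
    refine ⟨(normC0 α S φ).toReal + (normC0 α S (fderiv ℝ φ)).toReal, by positivity,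
      h0.mono (by linarith), h1.mono (by linarith), fun e he => ⟨fun z hz => ?_, fun z hz w hw => ?_⟩⟩
    · refine ((fderiv ℝ φ z).le_of_opNorm_le_of_le (h1.1 z hz) he).trans (by linarith)
    · refine ((fderiv ℝ φ z - fderiv ℝ φ w).le_of_opNorm_le_of_le (h1.2 z hz w hw) he).trans ?_
      rw [mul_one]
      gcongr
      linarith
  obtain ⟨CY, -, hY⟩ := HolderBound.exists_extension (Cn n × Cn n × Cn n) hα0' hα1'
  obtain ⟨y, hyS, hy⟩ := hY S R (fun z => (φ z, fderiv ℝ φ z 1, fderiv ℝ φ z Complex.I)) hR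
    (hφ0.prodMk ((hφe 1 (by simp)).prodMk (hφe Complex.I (by simp))))
  obtain ⟨CX, hCX, hX⟩ := HolderBound.exists_extension (Cn n) hα0' hα1'
  obtain ⟨δ, CV, hδ, hCV, hsol⟩ := exists_solution_nonlinear hα0' hα1' hJ.contDiff_jetOperator
    hJ.jetOperator_zero hy
  obtain ⟨CP, hCP, hP⟩ := HolderBound.exists_contDiff_comp
    (hJ.contDiff_conjugator.of_le (by norm_num : (1 : WithTop ℕ∞) ≤ 3)) α R
  have hdJ : ContDiff ℝ 1 (fderiv ℝ J) := hJ.smooth.fderiv_right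
    (WithTop.coe_le_coe.2 (le_top (a := (1 : ℕ∞) + 1)))
  obtain ⟨CD, hCD, hD⟩ := HolderBound.exists_contDiff_comp hdJ α R
  set A := 2 * CP + 2 * (2 * CD * R) with hA
  refine ⟨δ / (CX + 1), 2 * (A * (CV * CX)), by positivity, by positivity,
    fun Ω η hΩS hη hηδ hF => ?_⟩
  obtain ⟨f, hfΩ, hf⟩ := hX Ω η (opF J φ) hη hF
  have hfδ : CX * η ≤ δ := by
    rw [le_div_iff₀ (by positivity)] at hηδ
    linarith
  obtain ⟨V, hV, hVz⟩ := hsol f (CX * η) (by positivity) hfδ hf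
  set m := CV * (CX * η) with hm
  have hm0 : 0 ≤ m := by positivity
  have hVΩ := hV.mono_set (subset_univ Ω)
  have hv : HolderBound α Ω m (fun z => (V z).1) :=
    ⟨fun z hz => (norm_fst_le _).trans (hVΩ.1 z hz),
      fun z hz w hw => (norm_fst_le (V z - V w)).trans (hVΩ.2 z hz w hw)⟩
  have hV' : HolderBound α Ω m (fun z => (V z).2) :=
    ⟨fun z hz => (norm_snd_le _).trans (hVΩ.1 z hz),
      fun z hz w hw => (norm_snd_le (V z - V w)).trans (hVΩ.2 z hz w hw)⟩
  have hv1 : HolderBound α Ω m (fun z => (V z).2.1) :=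
    ⟨fun z hz => (norm_fst_le _).trans (hV'.1 z hz),
      fun z hz w hw => (norm_fst_le ((V z).2 - (V w).2)).trans (hV'.2 z hz w hw)⟩
  have hv2 : HolderBound α Ω m (fun z => (V z).2.2) :=
    ⟨fun z hz => (norm_snd_le _).trans (hV'.1 z hz),
      fun z hz w hw => (norm_snd_le ((V z).2 - (V w).2)).trans (hV'.2 z hz w hw)⟩
  set w : ℂ → Cn n := fun z => conjugator J (φ z) (V z).1 with hw
  have hPφ := hP Ω φ (hφ0.mono_set hΩS)
  have hDφ := hD Ω φ (hφ0.mono_set hΩS)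
  have hzφ : ∀ z ∈ Ω, HasFDerivAt φ (fderiv ℝ φ z) z := fun z hz =>
    ((hφd z (hΩS hz)).differentiableAt (Metric.isOpen_ball.mem_nhds (hΩS hz))).hasFDerivAt
  have hwd : ∀ z ∈ Ω, ∃ T : ℂ →L[ℝ] Cn n, HasFDerivAt w T z ∧
      T 1 = fderiv ℝ J (φ z) (fderiv ℝ φ z 1) (V z).1 + conjugator J (φ z) (V z).2.1 ∧
      T Complex.I = fderiv ℝ J (φ z) (fderiv ℝ φ z Complex.I) (V z).1
        + conjugator J (φ z) (V z).2.2 := by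
    intro z hz
    obtain ⟨⟨D, hD, hD1, hDI⟩, -⟩ := hVz z (mem_ball_zero_iff.1 (hΩS hz))
    have hJd : HasFDerivAt (conjugator J) (fderiv ℝ J (φ z)) (φ z) :=
      (((hJ.smooth.differentiable (by simp)) (φ z)).hasFDerivAt).const_add (Jst n)
    have h1 := (hJd.comp z (hzφ z hz)).clm_apply hD
    refine ⟨_, h1, ?_, ?_⟩
    · simp [hD1, add_comm]
    · simp [hDI, add_comm]
  have hu : ∀ z ∈ Ω, HasFDerivAt (fun z => φ z + w z) (fderiv ℝ φ z + fderiv ℝ w z) z := by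
    intro z hz
    obtain ⟨T, hT, -⟩ := hwd z hz
    exact (hzφ z hz).add hT.differentiableAt.hasFDerivAt
  have hw0 : HolderBound α Ω (2 * (A * (CV * CX)) * η) w := by
    refine (hPφ.clm_apply hv).mono ?_
    have e1 : 0 ≤ 2 * (2 * CD * R) * m := by positivity
    have e2 : 0 ≤ A * m := by positivity
    calc 2 * CP * m ≤ A * m + A * m := by rw [hA] at e2 ⊢; linarith [mul_nonneg hCP hm0]
      _ = _ := by rw [hm]; ring
  have hw1 : HolderBound α Ω (2 * (A * (CV * CX)) * η) (fderiv ℝ w) := by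
    have hq : ∀ e : ℂ, ‖e‖ ≤ 1 → HolderBound α Ω (2 * (2 * CD * R) * m)
        (fun z => fderiv ℝ J (φ z) (fderiv ℝ φ z e) (V z).1) := fun e he =>
      (hDφ.clm_apply ((hφe e he).mono_set hΩS)).clm_apply hv
    have hA' : 2 * (2 * CD * R) * m + 2 * CP * m ≤ A * m := by rw [hA]; linarith
    have k := HolderBound.of_apply (D := fderiv ℝ w) (S := Ω) (α := α) (M := A * m)
      ((((hq 1 (by simp)).add (hPφ.clm_apply hv1)).mono hA').congr fun z hz => ?_)
      ((((hq Complex.I (by simp)).add (hPφ.clm_apply hv2)).mono hA').congr fun z hz => ?_)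
    · exact k.mono (le_of_eq (by rw [hm]; ring))
    · obtain ⟨T, hT, hT1, -⟩ := hwd z hz
      rw [hT.fderiv, hT1]
    · obtain ⟨T, hT, -, hTI⟩ := hwd z hz
      rw [hT.fderiv, hTI]
  have hud : DifferentiableOn ℝ (fun z => φ z + w z) Ω := fun z hz =>
    (hu z hz).differentiableAt.differentiableWithinAt
  have hsub : (fun z => φ z + w z - φ z) = w := by
    funext z
    simp
  refine ⟨fun z => φ z + w z, ⟨hud, fun z hz v => ?_⟩,
    memC1_of_holderBound (M := R + 2 * (A * (CV * CX)) * η) (by positivity) hud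
      ((hφ0.mono_set hΩS).add hw0)
      (((hφ1.mono_set hΩS).add hw1).congr fun z hz => (hu z hz).fderiv), ?_, ?_⟩
  · rw [(hu z hz).fderiv]
    obtain ⟨T, hT, hT1, hTI⟩ := hwd z hz
    rw [hT.fderiv]
    set D := fderiv ℝ φ z + T with hD
    -- the equation solved by `V`, at a point of `Ω`
    have hzero : jetOperator J (y z, V z) = 0 := by
      rw [(hVz z (mem_ball_zero_iff.1 (hΩS hz))).2, hfΩ z hz, hJ.opF_eq, hyS z (hΩS hz), sub_self]
    have hker : J (φ z + w z) (D 1) = D Complex.I := by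
      rw [hyS z (hΩS hz), jetOperator] at hzero
      have h2 := congrArg (conjugator J (φ z)) hzero
      rw [hJ.conjugator_inverse_apply, map_zero, sub_eq_zero] at h2
      rw [hD, add_apply, add_apply, hT1, hTI, ← add_assoc, ← add_assoc]
      exact h2
    have hker' : J (φ z + w z) (D Complex.I) = -D 1 := by
      rw [← hker, hJ.apply_apply]
    have e1 : v = v.re • (1 : ℂ) + v.im • Complex.I := by simp
    have e2 : Complex.I * v = v.re • Complex.I - v.im • (1 : ℂ) := by
      apply Complex.ext <;> simp
    rw [e2]
    conv_lhs => rw [e1]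
    simp only [map_add, map_neg, map_smul, hker, hker', smul_neg, sub_eq_add_neg]
  · simpa only [hsub] using hw0
  · simpa only [hsub] using hw1

end Deformation

end JHolomorphic

theorem proposition4 (n : ℕ) (α : ℝ≥0) (hα0 : 0 < α) (hα1 : α < 1)
    (J : JHolomorphic.Cn n → JHolomorphic.Cn n →L[ℝ] JHolomorphic.Cn n)
    (hJ : JHolomorphic.IsAdmissible J)
    (Ω : ℕ → Set ℂ) (hΩ_open : ∀ m, IsOpen (Ω m)) (hΩ_sub : ∀ m, Ω m ⊆ Metric.ball (0 : ℂ) 1)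
    (φ : ℂ → JHolomorphic.Cn n) (hφ : JHolomorphic.MemC1 α (Metric.ball (0 : ℂ) 1) φ)
    (hF : Tendsto (fun m => JHolomorphic.normC0 α (Ω m) (JHolomorphic.opF J φ)) atTop (𝓝 0)) :
    ∃ u : ℕ → ℂ → JHolomorphic.Cn n,
      (∀ᶠ m in atTop,
        JHolomorphic.IsJHolomorphicOn J (u m) (Ω m) ∧ JHolomorphic.MemC1 α (Ω m) (u m)) ∧
      Tendsto (fun m => JHolomorphic.normC1 α (Ω m) (fun ζ => u m ζ - φ ζ)) atTop (𝓝 0) := by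
  obtain ⟨δ, C, hδ, hC, h⟩ := JHolomorphic.exists_isJHolomorphicOn_near hα0 hα1 hJ hφ
  set N : ℕ → ℝ≥0∞ := fun m => JHolomorphic.normC0 α (Ω m) (JHolomorphic.opF J φ) with hN
  have hu : ∀ m, ∃ u : ℂ → JHolomorphic.Cn n, N m ≤ ENNReal.ofReal δ →
      (JHolomorphic.IsJHolomorphicOn J u (Ω m) ∧ JHolomorphic.MemC1 α (Ω m) u) ∧
      JHolomorphic.normC1 α (Ω m) (fun ζ => u ζ - φ ζ) ≤ ENNReal.ofReal (4 * C) * N m := by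
    intro m
    by_cases hm : N m ≤ ENNReal.ofReal δ
    · have hfin : N m ≠ ⊤ := (hm.trans_lt ENNReal.ofReal_lt_top).ne
      have ht : 0 ≤ (N m).toReal := ENNReal.toReal_nonneg
      obtain ⟨u, hu1, hu2, hu3, hu4⟩ := h (Ω m) (N m).toReal (hΩ_sub m) ht
        (ENNReal.toReal_le_of_le_ofReal hδ.le hm) (JHolomorphic.holderBound_toReal_normC0 hfin)
      refine ⟨u, fun _ => ⟨⟨hu1, hu2⟩, ?_⟩⟩
      have hc : 0 ≤ C * (N m).toReal := by positivity
      refine (add_le_add (JHolomorphic.normC0_le_of_holderBound hc hu3)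
        (JHolomorphic.normC0_le_of_holderBound hc hu4)).trans (le_of_eq ?_)
      rw [← ENNReal.ofReal_add (by positivity) (by positivity)]
      conv_rhs => rw [← ENNReal.ofReal_toReal hfin]
      rw [← ENNReal.ofReal_mul (by positivity)]
      congr 1
      ring
    · -- for the finitely many remaining `m` the value of `u` does not matter
      exact ⟨0, fun hm' => absurd hm' hm⟩
  choose u hu using hu
  have hev : ∀ᶠ m in atTop, N m ≤ ENNReal.ofReal δ :=
    hF.eventually_le_const (ENNReal.ofReal_pos.2 hδ)
  refine ⟨u, hev.mono fun m hm => (hu m hm).1, ?_⟩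
  have hlim : Tendsto (fun m => ENNReal.ofReal (4 * C) * N m) atTop (𝓝 0) := by
    have := ENNReal.Tendsto.const_mul (a := ENNReal.ofReal (4 * C)) hF (Or.inr ENNReal.ofReal_ne_top)
    simpa using this
  exact tendsto_of_tendsto_of_tendsto_of_le_of_le' tendsto_const_nhds hlim
    (Eventually.of_forall fun _ => zero_le) (hev.mono fun m hm => (hu m hm).2)
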